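/- Let $\mathbb{N}=\{1,2,3,\dots\}$, $d>1$, and let $\{f_n\}_{n\ge1}$ be a $d$-decaying Gauss-like iterated function system, that is, a sequence of $C^1$ functions $f_n:[0,1]\to[0,1]$ such that (i) $f_i((0,1))\cap f_j((0,1))=\emptyset$ for all $i\ne j$; (ii) there are an integer $p\ge1$ and $0<\rho<1$ with $0<|(f_{a_1}\circ\cdots\circ f_{a_p})'(x)|\le\rho$ for all $(a_1,\dots,a_p)\in\mathbb{N}^p$ and $x\in[0,1]$; (iii) for every $\varepsilon>0$ there are $C_1,C_2>0$ such that for every $i\in\mathbb{N}$ there are constants $\xi_i,\lambda_i$ with $\frac{C_1}{i^{d+\varepsilon}}\le\xi_i\le\lambda_i\le\frac{C_2}{i^{d-\varepsilon}}$ and $\xi_i\le|f_i'(x)|\le\lambda_i$ for all $x\in[0,1]$; (iv) $\bigcup_{i\ge1}f_i([0,1])=(0,1]$, and $f_i(x)<f_j(x)$ for all $x\in[0,1]$ whenever $i>j$; (v) there is $\kappa\ge1$ with $|(f_{a_1}\circ\cdots\circ f_{a_n})'(x)|\le\kappa\,|(f_{a_1}\circ\cdots\circ f_{a_n})'(y)|$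 for all $n\ge1$, $(a_1,\dots,a_n)\in\mathbb{N}^n$ and $x,y\in[0,1]$. A sequence $(a_n(x))_{n\ge1}$ in $\mathbb{N}$ is the sequence of digits of $x$ if $x=\lim_{n\to\infty}f_{a_1(x)}\circ\cdots\circ f_{a_n(x)}(1)$; let $\Lambda$ be the set of $x\in(0,1)$ that have a digit sequence with $a_n(x)\le a_{n+1}(x)$ for all $n\ge1$. Let $m\ge1$ and let $t_0,\dots,t_m\ge0$ be real numbers with $t_0\ne0$ and $t_i\neq0$ for at least one $1\le i\le m$. For $0\le\alpha\le\infty$ put $$E(\Lambda,\alpha,\{t_i\})=\Big\{x\in\Lambda:\ \liminf_{n\to\infty}\frac{\log\big(a_n^{t_0}(x)\cdots a_{n+m}^{t_m}(x)\big)}{\log n}=\alpha\Big\},$$ and let $F(\Lambda,\alpha,\{t_i\})$ and $G(\Lambda,\alpha,\{t_i\})$ be the sets obtained by replacing $\liminf$ with $\lim$ and with $\limsup$, respectively. Then for every $0\le\alpha\le\infty$, $$\dim_{\rm H}F(\Lambda,\alpha,\{t_i\})=\dim_{\rm H}G(\Lambda,\alpha,\{t_i\})=\dim_{\rm H}E(\Lambda,\alpha,\{t_i\}).$$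 -/

import Mathlib

open Set Filter Topology MeasureTheory
open scoped ENNReal

/-- The composition `f_{a_1} ∘ ⋯ ∘ f_{a_n}` along the first `n` letters of `a`.
Positive integers are the letters, and `a k` is the letter usually written `a_{k+1}`. -/
def cylinderMap (f : ℕ+ → ℝ → ℝ) (a : ℕ → ℕ+) : ℕ → ℝ → ℝ
  | 0 => id
  | n + 1 => cylinderMap f a n ∘ f (a n)

/-- A `d`-decaying infinite iterated function system on `[0,1]`. Only the values of the maps on
`[0,1]` matter, and derivatives are those of the restrictions to `[0,1]` (one-sided at the
endpoints). Finite words of length `n` are the first `n` letters of infinite ones. -/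
structure IsDecayingIIFS (d : ℝ) (f : ℕ+ → ℝ → ℝ) : Prop where
  one_lt_d : 1 < d
  mapsTo : ∀ i, MapsTo (f i) (Icc 0 1) (Icc 0 1)
  contDiffOn : ∀ i, ContDiffOn ℝ 1 (f i) (Icc 0 1)
  openSet : ∀ i j, i ≠ j → f i '' Ioo 0 1 ∩ f j '' Ioo 0 1 = ∅
  contraction : ∃ m : ℕ, 1 ≤ m ∧ ∃ ρ : ℝ, 0 < ρ ∧ ρ < 1 ∧
    ∀ a : ℕ → ℕ+, ∀ x ∈ Icc (0 : ℝ) 1,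
      0 < |derivWithin (cylinderMap f a m) (Icc 0 1) x| ∧
        |derivWithin (cylinderMap f a m) (Icc 0 1) x| ≤ ρ
  regular : ∀ ε : ℝ, 0 < ε → ∃ C₁ C₂ : ℝ, 0 < C₁ ∧ 0 < C₂ ∧ ∀ i : ℕ+, ∃ ξ lam : ℝ,
    (∀ x ∈ Icc (0 : ℝ) 1,
      ξ ≤ |derivWithin (f i) (Icc 0 1) x| ∧ |derivWithin (f i) (Icc 0 1) x| ≤ lam) ∧
    C₁ / ((i : ℕ) : ℝ) ^ (d + ε) ≤ ξ ∧ ξ ≤ lam ∧ lam ≤ C₂ / ((i : ℕ) : ℝ) ^ (d - ε)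

/-- A `d`-decaying system is Gauss-like if its first-level cylinders fill out the unit interval in
decreasing order, and if it has bounded distortion. (The strict order forces every `f i` to be
positive on `[0,1]`, so the cylinders fill out `(0,1]`; they accumulate only at the point `0`.) -/
structure IsGaussLikeIIFS (d : ℝ) (f : ℕ+ → ℝ → ℝ) : Prop extends IsDecayingIIFS d f where
  cover : ⋃ i, f i '' Icc 0 1 = Ioc 0 1
  order : ∀ i j : ℕ+, j < i → ∀ x ∈ Icc (0 : ℝ) 1, f i x < f j x
  distortion : ∃ κ : ℝ, 1 ≤ κ ∧ ∀ (n : ℕ) (a : ℕ → ℕ+),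
    ∀ x ∈ Icc (0 : ℝ) 1, ∀ y ∈ Icc (0 : ℝ) 1,
      |derivWithin (cylinderMap f a n) (Icc 0 1) x| ≤
        κ * |derivWithin (cylinderMap f a n) (Icc 0 1) y|

/-- `a` is the sequence of digits of `x`, that is, `x = lim_n f_{a_1} ∘ ⋯ ∘ f_{a_n} (1)`. -/
def IsDigitSeq (f : ℕ+ → ℝ → ℝ) (x : ℝ) (a : ℕ → ℕ+) : Prop :=
  Tendsto (fun n => cylinderMap f a n 1) atTop (𝓝 x)

/-- The quotient `log (a_N ^ t_0 ⋯ a_{N+m} ^ t_m) / log N` for `N = n + 1`, in `[-∞, ∞]`. -/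
noncomputable def growthRatio {m : ℕ} (t : Fin (m + 1) → ℝ) (a : ℕ → ℕ+) (n : ℕ) : EReal :=
  ((Real.log (∏ i : Fin (m + 1), ((a (n + i) : ℕ) : ℝ) ^ t i) / Real.log ((n : ℝ) + 1) : ℝ) :
    EReal)

/-- The points of `(0,1)` that have a non-decreasing digit sequence with the property `P`. -/
def monotoneDigitSet (f : ℕ+ → ℝ → ℝ) (P : (ℕ → ℕ+) → Prop) : Set ℝ :=
  {x | x ∈ Ioo (0 : ℝ) 1 ∧ ∃ a : ℕ → ℕ+, IsDigitSeq f x a ∧ (∀ n, a n ≤ a (n + 1)) ∧ P a}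

/-- The level set `E(Λ, α, {t_i})` of the lower limit. -/
def liminfSet (f : ℕ+ → ℝ → ℝ) {m : ℕ} (t : Fin (m + 1) → ℝ) (α : ℝ≥0∞) : Set ℝ :=
  monotoneDigitSet f fun a => liminf (growthRatio t a) atTop = (α : EReal)

/-- The level set `F(Λ, α, {t_i})` of the limit. -/
def limSet (f : ℕ+ → ℝ → ℝ) {m : ℕ} (t : Fin (m + 1) → ℝ) (α : ℝ≥0∞) : Set ℝ :=
  monotoneDigitSet f fun a => Tendsto (growthRatio t a) atTop (𝓝 (α : EReal))

/-- The level set `G(Λ, α, {t_i})` of the upper limit. -/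
def limsupSet (f : ℕ+ → ℝ → ℝ) {m : ℕ} (t : Fin (m + 1) → ℝ) (α : ℝ≥0∞) : Set ℝ :=
  monotoneDigitSet f fun a => limsup (growthRatio t a) atTop = (α : EReal)

/-! Put `T = ∑ t_i` and `β = α / T`. The level set of the limit lies in the other two, and all three
lie in the set where the lower limit is at most `α`. It therefore suffices to bound the dimension of
this largest set by that of `limSet`, which is `dimH_liminf_le_dimH_limSet`. Both are compared with
the number `κ = max(0, 1 - 1/β) / d`, read as `1/d` for `α = ∞` and as `0` for `β = 0`.

Upper bound (`dimH_le_of_frequently_digit_le`). Monotonicity gives `log (a_n^{t_0} ⋯ a_{n+m}^{t_m})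
≥ T log a_n`, so a lower limit at most `α` forces `a_n^θ = o(n)` along a subsequence whenever `θ β <
1`. Cover by cylinders of non-decreasing words. With weights `w_j ≈ j^(-ds)`, the generating
function `∏_{j<N} (1 - z w_j)⁻¹ ≤ exp (2 z ∑_{j<N} w_j)` controls the total weight of such words
with letters below `N`. If `s d > 1 - θ`, the exponent is `O(N^θ)`, hence negligible against the
word length, and `z = e²` makes the covering sums converge.

Lower bound (`le_dimH_of_blocks`). Let `a_n` range over every second integer of a block of length
about `n^(β-1)` near `n^β`. Mixed radix expansions parametrize the resulting Cantor set by `[0,1)`,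
and the inverse of the parametrization is Hölder of every exponent `s < κ`. For `α = ∞` dyadic
blocks serve. -/

/-! ### Lipschitz bounds for the maps and their compositions; existence of coded points. -/

theorem abs_sub_bounds_of_derivWithin {g : ℝ → ℝ} (hg : ContDiffOn ℝ 1 g (Icc 0 1)) {ξ lam : ℝ}
    (h : ∀ x ∈ Icc (0 : ℝ) 1,
      ξ ≤ |derivWithin g (Icc 0 1) x| ∧ |derivWithin g (Icc 0 1) x| ≤ lam)
    {x y : ℝ} (hx : x ∈ Icc (0 : ℝ) 1) (hy : y ∈ Icc (0 : ℝ) 1) :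
    ξ * |x - y| ≤ |g x - g y| ∧ |g x - g y| ≤ lam * |x - y| := by
  wlog hxy : x < y generalizing x y
  · rcases eq_or_lt_of_le (not_lt.1 hxy) with rfl | hlt
    · simp
    · rw [abs_sub_comm x, abs_sub_comm (g x)]
      exact this hy hx hlt
  have hsub : Icc x y ⊆ Icc 0 1 := Icc_subset_Icc hx.1 hy.2
  have hnhds : ∀ c ∈ Ioo x y, Icc (0 : ℝ) 1 ∈ 𝓝 c := fun c hc =>
    Icc_mem_nhds (hx.1.trans_lt hc.1) (hc.2.trans_le hy.2)
  obtain ⟨c, hc, hceq⟩ := exists_deriv_eq_slope g hxy (hg.continuousOn.mono hsub)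
    (fun c hc => (((hg.differentiableOn one_ne_zero) c
      (hsub (Ioo_subset_Icc_self hc))).differentiableAt (hnhds c hc)).differentiableWithinAt)
  have hb := h c (hsub (Ioo_subset_Icc_self hc))
  rw [derivWithin_of_mem_nhds (hnhds c hc), hceq, abs_div] at hb
  have hpos : 0 < |y - x| := abs_pos.2 (sub_ne_zero.2 hxy.ne')
  rw [abs_sub_comm x, abs_sub_comm (g x)]
  exact ⟨(le_div_iff₀ hpos).1 hb.1, (div_le_iff₀ hpos).1 hb.2⟩

section Cylinder

variable {f : ℕ+ → ℝ → ℝ}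

theorem cylinderMap_congr {a b : ℕ → ℕ+} {n : ℕ} (h : ∀ k < n, a k = b k) :
    cylinderMap f a n = cylinderMap f b n := by
  induction n with
  | zero => rfl
  | succ n ih =>
    simp only [cylinderMap]
    rw [ih fun k hk => h k (hk.trans n.lt_succ_self), h n n.lt_succ_self]

theorem cylinderMap_add (a : ℕ → ℕ+) (n k : ℕ) :
    cylinderMap f a (n + k) = cylinderMap f a n ∘ cylinderMap f (fun i => a (n + i)) k := by
  induction k with
  | zero => rfl
  | succ k ih =>
    rw [← add_assoc, cylinderMap, ih]
    rfl

theorem cylinderMap_succ_eq (a : ℕ → ℕ+) (n : ℕ) :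
    cylinderMap f a (n + 1) = f (a 0) ∘ cylinderMap f (fun i => a (i + 1)) n := by
  rw [add_comm, cylinderMap_add]
  simp [cylinderMap, add_comm]

theorem cylinderMap_mapsTo (hf : ∀ i, MapsTo (f i) (Icc 0 1) (Icc 0 1)) (a : ℕ → ℕ+) (n : ℕ) :
    MapsTo (cylinderMap f a n) (Icc 0 1) (Icc 0 1) := by
  induction n with
  | zero => exact mapsTo_id _
  | succ n ih => exact ih.comp (hf _)

theorem cylinderMap_continuousOn (hf : ∀ i, MapsTo (f i) (Icc 0 1) (Icc 0 1))
    (hc : ∀ i, ContinuousOn (f i) (Icc 0 1)) (a : ℕ → ℕ+) (n : ℕ) :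
    ContinuousOn (cylinderMap f a n) (Icc 0 1) := by
  induction n with
  | zero => exact continuousOn_id
  | succ n ih => exact ih.comp (hc _) (hf _)

theorem abs_cylinderMap_sub_le (hf : ∀ i, MapsTo (f i) (Icc 0 1) (Icc 0 1)) {L : ℕ+ → ℝ}
    (hL : ∀ i, 0 ≤ L i)
    (h : ∀ i, ∀ x ∈ Icc (0 : ℝ) 1, ∀ y ∈ Icc (0 : ℝ) 1, |f i x - f i y| ≤ L i * |x - y|)
    (a : ℕ → ℕ+) (n : ℕ) {x y : ℝ} (hx : x ∈ Icc (0 : ℝ) 1) (hy : y ∈ Icc (0 : ℝ) 1) :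
    |cylinderMap f a n x - cylinderMap f a n y| ≤ (∏ k ∈ Finset.range n, L (a k)) * |x - y| := by
  induction n generalizing x y with
  | zero => simp [cylinderMap]
  | succ n ih =>
    rw [Finset.prod_range_succ, mul_assoc]
    exact (ih (hf _ hx) (hf _ hy)).trans (mul_le_mul_of_nonneg_left (h _ x hx y hy)
      (Finset.prod_nonneg fun k _ => hL _))

theorem le_abs_cylinderMap_sub (hf : ∀ i, MapsTo (f i) (Icc 0 1) (Icc 0 1)) {L : ℕ+ → ℝ}
    (hL : ∀ i, 0 ≤ L i)
    (h : ∀ i, ∀ x ∈ Icc (0 : ℝ) 1, ∀ y ∈ Icc (0 : ℝ) 1, L i * |x - y| ≤ |f i x - f i y|)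
    (a : ℕ → ℕ+) (n : ℕ) {x y : ℝ} (hx : x ∈ Icc (0 : ℝ) 1) (hy : y ∈ Icc (0 : ℝ) 1) :
    (∏ k ∈ Finset.range n, L (a k)) * |x - y| ≤ |cylinderMap f a n x - cylinderMap f a n y| := by
  induction n generalizing x y with
  | zero => simp [cylinderMap]
  | succ n ih =>
    rw [Finset.prod_range_succ, mul_assoc]
    exact (mul_le_mul_of_nonneg_left (h _ x hx y hy)
      (Finset.prod_nonneg fun k _ => hL _)).trans (ih (hf _ hx) (hf _ hy))

end Cylinder

namespace IsDecayingIIFS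

variable {d : ℝ} {f : ℕ+ → ℝ → ℝ}

theorem exists_abs_sub_le (hf : IsDecayingIIFS d f) {ε : ℝ} (hε : 0 < ε) :
    ∃ C : ℝ, 0 < C ∧ ∀ i : ℕ+, ∀ x ∈ Icc (0 : ℝ) 1, ∀ y ∈ Icc (0 : ℝ) 1,
      |f i x - f i y| ≤ C / ((i : ℕ) : ℝ) ^ (d - ε) * |x - y| := by
  obtain ⟨_, C, _, hC, h⟩ := hf.regular ε hε
  refine ⟨C, hC, fun i x hx y hy => ?_⟩
  obtain ⟨ξ, lam, hb, -, -, hlam⟩ := h i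
  exact (abs_sub_bounds_of_derivWithin (hf.contDiffOn i) hb hx hy).2.trans (by gcongr)

theorem exists_le_abs_sub (hf : IsDecayingIIFS d f) {ε : ℝ} (hε : 0 < ε) :
    ∃ C : ℝ, 0 < C ∧ ∀ i : ℕ+, ∀ x ∈ Icc (0 : ℝ) 1, ∀ y ∈ Icc (0 : ℝ) 1,
      C / ((i : ℕ) : ℝ) ^ (d + ε) * |x - y| ≤ |f i x - f i y| := by
  obtain ⟨C, _, hC, _, h⟩ := hf.regular ε hε
  refine ⟨C, hC, fun i x hx y hy => ?_⟩
  obtain ⟨ξ, lam, hb, hξ, -, -⟩ := h i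
  exact le_trans (by gcongr) (abs_sub_bounds_of_derivWithin (hf.contDiffOn i) hb hx hy).1

theorem continuousOn (hf : IsDecayingIIFS d f) (i : ℕ+) : ContinuousOn (f i) (Icc 0 1) :=
  (hf.contDiffOn i).continuousOn

theorem exists_forall_ge_half (hf : IsDecayingIIFS d f) :
    ∃ K : ℕ, ∀ i : ℕ+, K ≤ i → ∀ x ∈ Icc (0 : ℝ) 1, ∀ y ∈ Icc (0 : ℝ) 1,
      |f i x - f i y| ≤ 1 / 2 * |x - y| := by
  have hd := hf.one_lt_d
  obtain ⟨C, hC, h⟩ := hf.exists_abs_sub_le (ε := d / 2) (by linarith)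
  have ht : Tendsto (fun n : ℕ => C / (n : ℝ) ^ (d - d / 2)) atTop (𝓝 0) :=
    tendsto_const_nhds.div_atTop
      ((tendsto_rpow_atTop (by linarith)).comp tendsto_natCast_atTop_atTop)
  obtain ⟨K, hK⟩ := eventually_atTop.1 (ht.eventually (gt_mem_nhds (by norm_num : (0 : ℝ) < 1 / 2)))
  exact ⟨K, fun i hi x hx y hy => (h i x hx y hy).trans
    (mul_le_mul_of_nonneg_right (hK i hi).le (abs_nonneg _))⟩

theorem exists_isDigitSeq_of_forall_half (hf : IsDecayingIIFS d f) {a : ℕ → ℕ+}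
    (h : ∀ n, ∀ x ∈ Icc (0 : ℝ) 1, ∀ y ∈ Icc (0 : ℝ) 1,
      |f (a n) x - f (a n) y| ≤ 1 / 2 * |x - y|) :
    ∃ x ∈ Icc (0 : ℝ) 1, IsDigitSeq f x a := by
  have h1 : (1 : ℝ) ∈ Icc (0 : ℝ) 1 := by simp
  have key : ∀ n, ∀ x ∈ Icc (0 : ℝ) 1, ∀ y ∈ Icc (0 : ℝ) 1,
      |cylinderMap f a n x - cylinderMap f a n y| ≤ (1 / 2) ^ n * |x - y| := by
    intro n
    induction n with
    | zero => simp [cylinderMap]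
    | succ n ih =>
      intro x hx y hy
      rw [pow_succ, mul_assoc]
      exact (ih _ (hf.mapsTo _ hx) _ (hf.mapsTo _ hy)).trans
        (mul_le_mul_of_nonneg_left (h n x hx y hy) (by positivity))
  have hc : CauchySeq fun n => cylinderMap f a n 1 := by
    refine cauchySeq_of_le_geometric (1 / 2) 1 (by norm_num) fun n => ?_
    rw [Real.dist_eq]
    have h2 := hf.mapsTo (a n) h1
    refine (key n 1 h1 _ h2).trans ?_
    rw [one_mul]
    refine mul_le_of_le_one_right (by positivity) ?_
    rw [abs_le]
    constructor <;> linarith [h2.1, h2.2]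
  obtain ⟨x, hx⟩ := cauchySeq_tendsto_of_complete hc
  exact ⟨x, isClosed_Icc.mem_of_tendsto hx
    (Eventually.of_forall fun n => cylinderMap_mapsTo hf.mapsTo a n h1), hx⟩

theorem isDigitSeq_of_tail (hf : IsDecayingIIFS d f) {a : ℕ → ℕ+} {x : ℝ}
    (hx : x ∈ Icc (0 : ℝ) 1) (h : IsDigitSeq f x fun n => a (n + 1)) :
    IsDigitSeq f (f (a 0) x) a := by
  refine (tendsto_add_atTop_iff_nat 1).1 ?_
  simp only [cylinderMap_succ_eq]
  exact (hf.continuousOn (a 0) x hx).tendsto.comp (tendsto_nhdsWithin_iff.2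
    ⟨h, Eventually.of_forall fun n => cylinderMap_mapsTo hf.mapsTo _ n (by simp)⟩)

/-- Only finitely many maps fail to halve distances, so some tail of `a` codes a point; applying the
finitely many initial maps to it gives the point coded by `a`. -/
theorem exists_isDigitSeq (hf : IsDecayingIIFS d f) {a : ℕ → ℕ+}
    (ha : Tendsto (fun n => (a n : ℕ)) atTop atTop) : ∃ x ∈ Icc (0 : ℝ) 1, IsDigitSeq f x a := by
  obtain ⟨K, hK⟩ := hf.exists_forall_ge_half
  obtain ⟨q, hq⟩ := eventually_atTop.1 (ha.eventually_ge_atTop K)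
  clear ha
  induction q generalizing a with
  | zero => exact hf.exists_isDigitSeq_of_forall_half fun n => hK _ (hq n n.zero_le)
  | succ q ih =>
    obtain ⟨x, hx, h⟩ := ih (a := fun n => a (n + 1)) fun n hn => hq _ (by omega)
    exact ⟨_, hf.mapsTo _ hx, hf.isDigitSeq_of_tail hx h⟩

theorem _root_.IsDigitSeq.mem_image_cylinderMap (hf : IsDecayingIIFS d f) {a : ℕ → ℕ+} {x : ℝ}
    (h : IsDigitSeq f x a) (n : ℕ) : x ∈ cylinderMap f a n '' Icc 0 1 := by
  refine (isCompact_Icc.image_of_continuousOn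
    (cylinderMap_continuousOn hf.mapsTo hf.continuousOn a n)).isClosed.mem_of_tendsto h
    (eventually_atTop.2 ⟨n, fun k hk => ?_⟩)
  obtain ⟨k, rfl⟩ := Nat.exists_eq_add_of_le hk
  rw [cylinderMap_add]
  exact mem_image_of_mem _ (cylinderMap_mapsTo hf.mapsTo _ k (by simp))

theorem _root_.IsDigitSeq.mem_Icc (hf : IsDecayingIIFS d f) {a : ℕ → ℕ+} {x : ℝ}
    (h : IsDigitSeq f x a) : x ∈ Icc (0 : ℝ) 1 := by
  simpa [cylinderMap] using h.mem_image_cylinderMap hf 0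

end IsDecayingIIFS

/-! ### Total weight of non-decreasing words. -/

section MonotoneWords

/-- A positive potential that drops by at least `z * w j` times its value at each `j`
with `z * w j ≤ 1 / 2`. -/
noncomputable def expPotential (w : ℕ → ℝ) (z : ℝ) (j : ℕ) : ℝ :=
  Real.exp (-(2 * z * ∑ i ∈ Finset.range j, w i))

theorem expPotential_pos (w : ℕ → ℝ) (z : ℝ) (j : ℕ) : 0 < expPotential w z j := Real.exp_pos _

variable {w : ℕ → ℝ} {z : ℝ} {K : ℕ}

theorem mul_expPotential_le (hw : ∀ j, 0 ≤ w j) (hz : 0 < z) {j : ℕ} (hj : z * w j ≤ 1 / 2) :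
    w j * expPotential w z j ≤ (expPotential w z j - expPotential w z (j + 1)) / z := by
  have hu : 0 ≤ z * w j := mul_nonneg hz.le (hw j)
  have hstep : expPotential w z (j + 1) = expPotential w z j * Real.exp (-(2 * (z * w j))) := by
    rw [expPotential, expPotential, ← Real.exp_add, Finset.sum_range_succ]
    ring_nf
  -- With `u = z * w j`, this follows from `exp (2u) ≥ 1 + 2u` and `(1 + 2u)(1 - u) ≥ 1`, the latter
  -- because `0 ≤ u ≤ 1/2`.
  have hexp : Real.exp (-(2 * (z * w j))) ≤ 1 - z * w j := by
    rw [Real.exp_neg]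
    have h1 := Real.add_one_le_exp (2 * (z * w j))
    refine (inv_anti₀ (by linarith) h1).trans ?_
    rw [inv_le_iff_one_le_mul₀ (by linarith)]
    nlinarith
  rw [le_div_iff₀ hz, hstep]
  nlinarith [mul_le_mul_of_nonneg_left hexp (expPotential_pos w z j).le]

theorem tsum_mul_expPotential_le (hw : ∀ j, 0 ≤ w j) (hz : 0 < z)
    (hK : ∀ j, K ≤ j → z * w j ≤ 1 / 2) :
    ∑' j : ℕ, (if K ≤ j then ENNReal.ofReal (w j * expPotential w z j) else 0) ≤
      ENNReal.ofReal (expPotential w z K / z) := by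
  -- The potential drops telescope; `max N K` accounts for the vanishing terms below `K`.
  have key : ∀ N, ∑ j ∈ Finset.range N, (if K ≤ j then w j * expPotential w z j else 0) ≤
      (expPotential w z K - expPotential w z (max N K)) / z := by
    intro N
    induction N with
    | zero => simp
    | succ N ih =>
      rw [Finset.sum_range_succ]
      split_ifs with h
      · have := mul_expPotential_le hw hz (hK N h)
        rw [max_eq_left h, sub_div] at ih
        rw [max_eq_left (h.trans N.le_succ), sub_div]
        rw [sub_div] at this
        linarith
      · rw [max_eq_right (by omega)] at ih ⊢
        simpa using ih
  refine ENNReal.tsum_le_of_sum_range_le fun N => ?_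
  have hite : ∀ j, (if K ≤ j then ENNReal.ofReal (w j * expPotential w z j) else 0) =
      ENNReal.ofReal (if K ≤ j then w j * expPotential w z j else 0) := fun j => by
    split_ifs <;> simp
  simp_rw [hite]
  rw [← ENNReal.ofReal_sum_of_nonneg fun j _ => ?_]
  · refine ENNReal.ofReal_le_ofReal ((key N).trans ?_)
    gcongr
    linarith [expPotential_pos w z (max N K)]
  · split_ifs
    · exact mul_nonneg (hw j) (expPotential_pos w z j).le
    · exact le_rfl

/-- The total weight of the non-decreasing words of length `n + 1` with letters at least `K`. -/
theorem tsum_monotone_words_le (hw : ∀ j, 0 ≤ w j) (hz : 0 < z)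
    (hK : ∀ j, K ≤ j → z * w j ≤ 1 / 2) (n : ℕ) :
    ∑' v : Fin (n + 1) → ℕ+, (if Monotone v ∧ K ≤ (v 0 : ℕ) then
      ENNReal.ofReal ((∏ i, w (v i)) * expPotential w z (v (Fin.last n))) else 0) ≤
      ENNReal.ofReal (expPotential w z K / z ^ (n + 1)) := by
  classical
  have hcast : ∀ g : ℕ → ℝ≥0∞, ∑' j : ℕ+, g j ≤ ∑' j : ℕ, g j := fun g =>
    ENNReal.tsum_comp_le_tsum_of_injective PNat.coe_injective g
  induction n generalizing K with
  | zero =>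
    rw [← (Equiv.funUnique (Fin 1) ℕ+).symm.tsum_eq]
    simpa [Subsingleton.monotone] using (hcast _).trans (tsum_mul_expPotential_le hw hz hK)
  | succ n ih =>
    -- Split off the first letter `j`. The rest is a non-decreasing word with letters at least `j`,
    -- so the induction hypothesis applies with `j` in place of `K`.
    rw [← (Fin.consEquiv fun _ => ℕ+).tsum_eq, ENNReal.tsum_prod']
    calc _ ≤ ∑' j : ℕ+, (if K ≤ (j : ℕ) then
          ENNReal.ofReal (w j * expPotential w z j) else 0) * ENNReal.ofReal (1 / z ^ (n + 1)) := by
          refine ENNReal.tsum_le_tsum fun j => ?_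
          split_ifs with hj
          · have h := ih (K := j) fun i hi => hK i (hj.trans hi)
            calc _ ≤ ∑' v : Fin (n + 1) → ℕ+, ENNReal.ofReal (w j) *
                  (if Monotone v ∧ (j : ℕ) ≤ (v 0 : ℕ) then
                  ENNReal.ofReal ((∏ i, w (v i)) * expPotential w z (v (Fin.last n))) else 0) := by
                  refine ENNReal.tsum_le_tsum fun v => ?_
                  have hm : Monotone (Fin.consEquiv (fun _ : Fin (n + 2) => ℕ+) (j, v)) ↔
                    j ≤ v 0 ∧ Monotone v := monotone_vecCons
                  by_cases hv : Monotone v ∧ (j : ℕ) ≤ (v 0 : ℕ)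
                  · rw [if_pos hv, if_pos ⟨hm.2 ⟨hv.2, hv.1⟩, by simpa using hj⟩,
                      ← ENNReal.ofReal_mul (hw j), Fin.prod_univ_succ, mul_assoc,
                      ← Fin.succ_last]
                    simp only [Fin.consEquiv_apply, Fin.cons_zero, Fin.cons_succ]
                    exact le_rfl
                  · rw [if_neg fun h => hv ⟨(hm.1 h.1).2, (hm.1 h.1).1⟩]
                    exact zero_le
              _ ≤ ENNReal.ofReal (w j) * ENNReal.ofReal (expPotential w z j / z ^ (n + 1)) := by
                  rw [ENNReal.tsum_mul_left]
                  gcongr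
              _ = _ := by
                  rw [← ENNReal.ofReal_mul (hw j), ← ENNReal.ofReal_mul
                    (mul_nonneg (hw j) (expPotential_pos _ _ _).le)]
                  congr 1
                  ring
          · rw [zero_mul, nonpos_iff_eq_zero, ENNReal.tsum_eq_zero]
            intro v
            rw [if_neg]
            simp [Fin.consEquiv_apply, hj]
      _ ≤ ENNReal.ofReal (expPotential w z K / z) * ENNReal.ofReal (1 / z ^ (n + 1)) := by
          rw [ENNReal.tsum_mul_right]
          gcongr
          exact (hcast fun j => if K ≤ j then
            ENNReal.ofReal (w j * expPotential w z j) else 0).trans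
            (tsum_mul_expPotential_le hw hz hK)
      _ = _ := by
          rw [← ENNReal.ofReal_mul (div_nonneg (expPotential_pos _ _ _).le hz.le)]
          congr 1
          field_simp
          ring

end MonotoneWords

/-! ### Upper bound for the dimension. -/

/-- Extends a finite word to an infinite one by the letter `1`. -/
def extendWord {n : ℕ} (v : Fin n → ℕ+) (k : ℕ) : ℕ+ := if h : k < n then v ⟨k, h⟩ else 1

/-- Upper bound for the dimension of the points with non-decreasing digits that are all at least
`K`, where `K` is large enough for the weights `(C / j ^ γ) ^ s`. -/
theorem dimH_le_of_forall_digit_ge {d : ℝ} {f : ℕ+ → ℝ → ℝ} (hf : IsDecayingIIFS d f)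
    {L : ℕ → ℝ} (hL0 : ∀ j, 0 ≤ L j)
    (hL : ∀ i : ℕ+, ∀ x ∈ Icc (0 : ℝ) 1, ∀ y ∈ Icc (0 : ℝ) 1, |f i x - f i y| ≤ L i * |x - y|)
    {s : NNReal} (hs : 0 < s) {K : ℕ} (hK : ∀ j, K ≤ j → L j ≤ 1 / 2)
    (hK' : ∀ j, K ≤ j → Real.exp 2 * L j ^ (s : ℝ) ≤ 1 / 2) :
    dimH {x | ∃ a : ℕ → ℕ+, IsDigitSeq f x a ∧ Monotone a ∧ (∀ n, K ≤ (a n : ℕ)) ∧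
      ∃ᶠ n : ℕ in atTop,
        2 * Real.exp 2 * ∑ i ∈ Finset.range (a n), L i ^ (s : ℝ) ≤ (n : ℝ) + 1} ≤ s := by
  classical
  set w : ℕ → ℝ := fun j => L j ^ (s : ℝ) with hw
  have hw0 : ∀ j, 0 ≤ w j := fun j => Real.rpow_nonneg (hL0 j) _
  set S := {x | ∃ a : ℕ → ℕ+, IsDigitSeq f x a ∧ Monotone a ∧ (∀ n, K ≤ (a n : ℕ)) ∧
      ∃ᶠ n : ℕ in atTop, 2 * Real.exp 2 * ∑ i ∈ Finset.range (a n), w i ≤ (n : ℝ) + 1} with hS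
  let good : ∀ n : ℕ, (Fin (n + 1) → ℕ+) → Prop := fun n v =>
    (Monotone v ∧ K ≤ (v 0 : ℕ)) ∧
      2 * Real.exp 2 * ∑ i ∈ Finset.range (v (Fin.last n)), w i ≤ (n : ℝ) + 1
  let cyl : ∀ n : ℕ, (Fin (n + 1) → ℕ+) → Set ℝ := fun n v =>
    cylinderMap f (extendWord v) (n + 1) '' Icc 0 1
  let cover : ℕ → (Σ n : ℕ, Fin (n + 1) → ℕ+) → Set ℝ := fun M p =>
    if M ≤ p.1 ∧ good p.1 p.2 then cyl p.1 p.2 else ∅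
  have hdiam : ∀ n v, Metric.ediam (cyl n v) ≤ ENNReal.ofReal (∏ i, L (v i)) := by
    intro n v
    refine Metric.ediam_le ?_
    rintro _ ⟨x, hx, rfl⟩ _ ⟨y, hy, rfl⟩
    rw [edist_dist, Real.dist_eq]
    refine ENNReal.ofReal_le_ofReal ((abs_cylinderMap_sub_le hf.mapsTo (L := fun i => L i)
      (fun i => hL0 i) hL _ (n + 1) hx hy).trans ?_)
    have hprod : ∏ k ∈ Finset.range (n + 1), L (extendWord v k) = ∏ i, L (v i) := by
      rw [← Fin.prod_univ_eq_prod_range (fun k => L (extendWord v k))]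
      exact Finset.prod_congr rfl fun i _ => by simp [extendWord, i.is_le]
    rw [hprod]
    refine mul_le_of_le_one_right (Finset.prod_nonneg fun i _ => hL0 _) ?_
    rw [abs_le]
    constructor <;> linarith [hx.1, hx.2, hy.1, hy.2]
  have hgood : ∀ n v, good n v → ∏ i, L (v i) ≤ (1 / 2) ^ n := by
    intro n v hv
    have h1 : ∏ i, L (v i) ≤ ∏ _i : Fin (n + 1), (1 / 2 : ℝ) :=
      Finset.prod_le_prod (fun i _ => hL0 _) fun i _ =>
        hK _ (hv.1.2.trans (PNat.coe_le_coe _ _ |>.2 (hv.1.1 (Fin.zero_le i))))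
    refine h1.trans ?_
    rw [Finset.prod_const, Finset.card_univ, Fintype.card_fin, pow_succ]
    have : (0 : ℝ) < (1 / 2) ^ n := by positivity
    linarith
  have hcover : ∀ M, S ⊆ ⋃ p, cover M p := by
    rintro M x ⟨a, hx, hmono, hKa, hfreq⟩
    obtain ⟨n, hn, hMn⟩ := (hfreq.and_eventually (eventually_ge_atTop M)).exists
    let v : Fin (n + 1) → ℕ+ := fun i => a i
    have hv : good n v := ⟨⟨fun i j hij => hmono (by exact_mod_cast hij), hKa _⟩, by simpa [v] using hn⟩
    refine mem_iUnion.2 ⟨⟨n, v⟩, ?_⟩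
    have hc : cover M ⟨n, v⟩ = cyl n v := if_pos ⟨hMn, hv⟩
    rw [hc]
    have := hx.mem_image_cylinderMap hf (n + 1)
    rwa [cylinderMap_congr (b := extendWord v) fun k hk => by simp [extendWord, v, hk]] at this
  -- For `z = e²` a good word has potential at least `exp (-(n+1))`, while words of length `n + 1`
  -- have total weight at most `exp (-2(n+1))`. The quotient is a geometric series.
  have hsum : ∀ M, ∑' p, Metric.ediam (cover M p) ^ (s : ℝ) ≤
      ∑' n : ℕ, ENNReal.ofReal (Real.exp (-1)) ^ (n + 1) := by
    intro M
    rw [ENNReal.tsum_sigma']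
    refine ENNReal.tsum_le_tsum fun n => ?_
    have hterm : ∀ v, Metric.ediam (cover M ⟨n, v⟩) ^ (s : ℝ) ≤ ENNReal.ofReal (Real.exp (n + 1)) *
        (if Monotone v ∧ K ≤ (v 0 : ℕ) then ENNReal.ofReal
          ((∏ i, w (v i)) * expPotential w (Real.exp 2) (v (Fin.last n))) else 0) := by
      intro v
      by_cases hv : M ≤ n ∧ good n v
      · have hc : cover M ⟨n, v⟩ = cyl n v := if_pos hv
        rw [hc, if_pos hv.2.1, ← ENNReal.ofReal_mul (Real.exp_pos _).le]
        refine (ENNReal.rpow_le_rpow (hdiam n v) s.2).trans ?_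
        rw [ENNReal.ofReal_rpow_of_nonneg (Finset.prod_nonneg fun i _ => hL0 _) s.2,
          ← Real.finsetProd_rpow _ _ fun i _ => hL0 _]
        refine ENNReal.ofReal_le_ofReal ?_
        rw [mul_left_comm]
        refine le_mul_of_one_le_right (Finset.prod_nonneg fun i _ => hw0 _) ?_
        rw [expPotential, ← Real.exp_add]
        exact Real.one_le_exp (by linarith [hv.2.2])
      · have hc : cover M ⟨n, v⟩ = ∅ := if_neg hv
        rw [hc, Metric.ediam_empty, ENNReal.zero_rpow_of_pos (by exact_mod_cast hs)]
        exact zero_le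
    refine (ENNReal.tsum_le_tsum hterm).trans ?_
    rw [ENNReal.tsum_mul_left]
    refine (mul_le_mul_right (tsum_monotone_words_le hw0 (Real.exp_pos 2) hK' n) _).trans ?_
    rw [← ENNReal.ofReal_mul (Real.exp_pos _).le, ← ENNReal.ofReal_pow (Real.exp_pos _).le]
    refine ENNReal.ofReal_le_ofReal ?_
    have h1 : expPotential w (Real.exp 2) K ≤ 1 := by
      rw [expPotential, Real.exp_le_one_iff]
      have := Finset.sum_nonneg fun i (_ : i ∈ Finset.range K) => hw0 i
      have := mul_nonneg (mul_pos two_pos (Real.exp_pos 2)).le this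
      linarith
    calc Real.exp (n + 1) * (expPotential w (Real.exp 2) K / Real.exp 2 ^ (n + 1))
        ≤ Real.exp (n + 1) * (1 / Real.exp 2 ^ (n + 1)) := by gcongr
      _ = Real.exp (-1) ^ (n + 1) := by
          rw [← Real.exp_nat_mul, ← Real.exp_nat_mul, one_div, ← Real.exp_neg, ← Real.exp_add]
          congr 1
          push_cast
          ring
  refine dimH_le_of_hausdorffMeasure_ne_top (ne_top_of_le_ne_top ?_
    (Measure.hausdorffMeasure_le_liminf_tsum (l := atTop) (s : ℝ) S
      (fun M : ℕ => ENNReal.ofReal ((1 / 2) ^ M)) ?_ cover (Eventually.of_forall ?_)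
      (Eventually.of_forall hcover)))
  · refine ne_top_of_le_ne_top ?_ ((liminf_le_liminf (Eventually.of_forall hsum)).trans
      (liminf_const _).le)
    simp_rw [pow_succ]
    rw [ENNReal.tsum_mul_right, ENNReal.tsum_geometric]
    refine ENNReal.mul_ne_top (ENNReal.inv_ne_top.2 (tsub_pos_iff_lt.2 ?_).ne') ENNReal.ofReal_ne_top
    rw [ENNReal.ofReal_lt_one]
    exact Real.exp_lt_one_iff.2 (by norm_num)
  · rw [← ENNReal.ofReal_zero]
    exact ENNReal.tendsto_ofReal (tendsto_pow_atTop_nhds_zero_of_lt_one (by norm_num) (by norm_num))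
  · rintro M ⟨n, v⟩
    by_cases hv : M ≤ n ∧ good n v
    · have hc : cover M ⟨n, v⟩ = cyl n v := if_pos hv
      rw [hc]
      refine (hdiam n v).trans (ENNReal.ofReal_le_ofReal ((hgood n v hv.2).trans ?_))
      exact pow_le_pow_of_le_one (by norm_num) (by norm_num) hv.1
    · have hc : cover M ⟨n, v⟩ = ∅ := if_neg hv
      rw [hc, Metric.ediam_empty]
      exact zero_le

/-- A bounded non-decreasing sequence is eventually constant, hence determined by a finite word. -/
theorem countable_setOf_isDigitSeq_bounded (f : ℕ+ → ℝ → ℝ) (K : ℕ) :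
    {x | ∃ a : ℕ → ℕ+, IsDigitSeq f x a ∧ Monotone a ∧ ∀ n, (a n : ℕ) < K}.Countable := by
  refine Countable.mono (s₂ := ⋃ q : ℕ, ⋃ v : Fin (q + 1) → ℕ+,
    {x | IsDigitSeq f x fun k => v ⟨min k q, by omega⟩}) ?_
    (countable_iUnion fun q => countable_iUnion fun v =>
      Set.Subsingleton.countable fun x hx y hy => tendsto_nhds_unique hx hy)
  rintro x ⟨a, hx, hmono, hK⟩
  obtain ⟨b, ⟨q, rfl⟩, hq⟩ := Set.exists_max_image (range fun n => (a n : ℕ)) id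
    ((finite_Iio K).subset (range_subset_iff.2 hK)) (range_nonempty _)
  refine mem_iUnion.2 ⟨q, mem_iUnion.2 ⟨fun i => a i, ?_⟩⟩
  have ha : (fun k => a (min k q)) = a := by
    funext k
    rcases le_total k q with h | h
    · rw [min_eq_left h]
    · rw [min_eq_right h]
      exact le_antisymm (hmono h) (PNat.coe_le_coe _ _ |>.1 (hq _ ⟨k, rfl⟩))
  simpa [ha] using hx

/-- Deleting the first digit presents the set for `q + 1` as part of a countable union of Lipschitz
images of the set for `q`. The condition is asked for every `δ` so that it survives the shift of the
index. -/
theorem dimH_le_of_eventually_digit_ge {d : ℝ} {f : ℕ+ → ℝ → ℝ} (hf : IsDecayingIIFS d f)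
    {φ : ℕ → ℝ} {K : ℕ} {D : ℝ≥0∞}
    (h0 : dimH {x | ∃ a : ℕ → ℕ+, IsDigitSeq f x a ∧ Monotone a ∧ (∀ n, K ≤ (a n : ℕ)) ∧
      ∀ δ > 0, ∃ᶠ n : ℕ in atTop, φ (a n) ≤ δ * ((n : ℝ) + 1)} ≤ D) (q : ℕ) :
    dimH {x | ∃ a : ℕ → ℕ+, IsDigitSeq f x a ∧ Monotone a ∧ (∀ n, q ≤ n → K ≤ (a n : ℕ)) ∧
      ∀ δ > 0, ∃ᶠ n : ℕ in atTop, φ (a n) ≤ δ * ((n : ℝ) + 1)} ≤ D := by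
  induction q with
  | zero => simpa using h0
  | succ q ih =>
    set A := {x | ∃ a : ℕ → ℕ+, IsDigitSeq f x a ∧ Monotone a ∧ (∀ n, q ≤ n → K ≤ (a n : ℕ)) ∧
      ∀ δ > 0, ∃ᶠ n : ℕ in atTop, φ (a n) ≤ δ * ((n : ℝ) + 1)} with hA
    have hsub : A ⊆ Icc 0 1 := fun x ⟨a, ha, _⟩ => ha.mem_Icc hf
    have himage : ∀ i, dimH (f i '' A) ≤ dimH A := by
      intro i
      obtain ⟨C, hC, h⟩ := hf.exists_abs_sub_le (ε := 1) one_pos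
      refine LipschitzOnWith.dimH_image_le (K := (C / ((i : ℕ) : ℝ) ^ (d - 1)).toNNReal)
        (LipschitzOnWith.of_dist_le_mul fun x hx y hy => ?_)
      rw [Real.coe_toNNReal _ (by positivity)]
      exact h i x (hsub hx) y (hsub hy)
    refine (dimH_mono (t := ⋃ i, f i '' A) ?_).trans ?_
    · rintro x ⟨a, hx, hmono, hK, hfreq⟩
      have hx' := hx
      rw [IsDigitSeq, ← tendsto_add_atTop_iff_nat 1] at hx'
      simp only [cylinderMap_succ_eq] at hx'
      obtain ⟨y, hy, rfl⟩ : x ∈ f (a 0) '' Icc 0 1 := by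
        simpa [cylinderMap] using hx.mem_image_cylinderMap hf 1
      refine mem_iUnion.2 ⟨a 0, y, ⟨fun n => a (n + 1), ?_, fun m n hmn => hmono (by omega),
        fun n hn => hK _ (by omega), fun δ hδ h => ?_⟩, rfl⟩
      -- The inverse of `f (a 0)` is Lipschitz on its image, so convergence passes from `x` to its
      -- preimage `y`.
      · obtain ⟨c, hc, hlow⟩ := hf.exists_le_abs_sub (ε := 1) one_pos
        have hc' : 0 < c / ((a 0 : ℕ) : ℝ) ^ (d + 1) := by
          have := (a 0).pos
          positivity
        have hlim := ((tendsto_iff_dist_tendsto_zero.1 hx').const_mul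
          (c / ((a 0 : ℕ) : ℝ) ^ (d + 1))⁻¹)
        rw [mul_zero] at hlim
        refine tendsto_iff_dist_tendsto_zero.2
          (squeeze_zero (fun _ => dist_nonneg) (fun n => ?_) hlim)
        rw [inv_mul_eq_div, le_div_iff₀ hc', mul_comm]
        exact hlow _ _ (cylinderMap_mapsTo hf.mapsTo _ n (by simp)) _ hy
      -- Half of `δ` suffices, since `n + 2 ≤ 2 (n + 1)`.
      · refine hfreq (δ / 2) (half_pos hδ) ?_
        rw [← map_add_atTop_eq_nat 1, eventually_map]
        filter_upwards [h] with n hn hle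
        refine hn (hle.trans ?_)
        push_cast
        nlinarith [mul_nonneg hδ.le (Nat.cast_nonneg (α := ℝ) n)]
    · rw [dimH_iUnion]
      exact iSup_le fun i => (himage i).trans ih

/-- For `0 < i < N`, `i^(-σ) = i^θ i^(-(σ+θ)) ≤ N^θ i^(-(σ+θ))`, which is summable. The last factor
discards `i = 0`, where `1 / 0 ^ σ` is `1` if `σ = 0`. -/
theorem sum_range_rpow_neg_le {σ θ : ℝ} (hθ : 0 ≤ θ) (h : 1 < σ + θ) :
    ∃ B : ℝ, 0 < B ∧ ∀ N : ℕ, ∑ i ∈ Finset.range N, (1 / (i : ℝ) ^ σ) * (if i = 0 then 0 else 1) ≤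
      B * (N : ℝ) ^ θ := by
  have hsum : Summable fun i : ℕ => 1 / (i : ℝ) ^ (σ + θ) := Real.summable_one_div_nat_rpow.2 h
  have hnn : 0 ≤ ∑' i : ℕ, 1 / (i : ℝ) ^ (σ + θ) := tsum_nonneg fun i => by positivity
  refine ⟨(∑' i : ℕ, 1 / (i : ℝ) ^ (σ + θ)) + 1, by linarith, fun N => ?_⟩
  have h1 : ∑ i ∈ Finset.range N, 1 / (i : ℝ) ^ (σ + θ) ≤ (∑' i : ℕ, 1 / (i : ℝ) ^ (σ + θ)) + 1 :=
    (hsum.sum_le_tsum _ fun i _ => by positivity).trans (by linarith)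
  refine le_trans ?_ (mul_le_mul_of_nonneg_right h1 (by positivity))
  rw [Finset.sum_mul]
  refine Finset.sum_le_sum fun i hi => ?_
  rcases Nat.eq_zero_or_pos i with rfl | hi0
  · simp only [if_true, mul_zero]
    positivity
  · rw [if_neg hi0.ne', mul_one]
    have hi' : (0 : ℝ) < i := by exact_mod_cast hi0
    have hiN : (i : ℝ) ≤ N := by exact_mod_cast (Finset.mem_range.1 hi).le
    have h2 : (i : ℝ) ^ θ ≤ (N : ℝ) ^ θ := Real.rpow_le_rpow hi'.le hiN hθ
    rw [Real.rpow_add hi', one_div, one_div, mul_inv, mul_assoc]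
    refine le_mul_of_one_le_right (by positivity) ?_
    rw [inv_mul_eq_div, one_le_div (by positivity)]
    exact h2

theorem dimH_le_of_frequently_digit_le {d : ℝ} {f : ℕ+ → ℝ → ℝ} (hf : IsDecayingIIFS d f)
    {s : NNReal} (hs : 0 < s) {θ : ℝ} (hθ : 0 ≤ θ) (hsd : 1 - θ < s * d) :
    dimH {x | ∃ a : ℕ → ℕ+, IsDigitSeq f x a ∧ Monotone a ∧
      ∀ δ > 0, ∃ᶠ n : ℕ in atTop, ((a n : ℕ) : ℝ) ^ θ ≤ δ * ((n : ℝ) + 1)} ≤ s := by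
  have hs' : (0 : ℝ) < s := by exact_mod_cast hs
  have hd := hf.one_lt_d
  obtain ⟨ε, hε, hεd, hσ⟩ : ∃ ε : ℝ, 0 < ε ∧ 0 < d - ε ∧ 1 < (d - ε) * s + θ := by
    -- The second entry makes `ε s` at most half of the slack `s d - (1 - θ)`.
    refine ⟨min (d / 2) ((s * d - (1 - θ)) / (2 * s)), ?_, ?_, ?_⟩
    · exact lt_min (by linarith) (div_pos (by linarith) (by linarith))
    · linarith [min_le_left (d / 2) ((s * d - (1 - θ)) / (2 * s))]
    · have h := min_le_right (d / 2) ((s * d - (1 - θ)) / (2 * s))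
      rw [le_div_iff₀ (by linarith)] at h
      nlinarith
  obtain ⟨C, hC, hL⟩ := hf.exists_abs_sub_le hε
  set L : ℕ → ℝ := fun j => C / (j : ℝ) ^ (d - ε) with hLdef
  have hL0 : ∀ j, 0 ≤ L j := fun j => by positivity
  have hlim : Tendsto L atTop (𝓝 0) := tendsto_const_nhds.div_atTop
    ((tendsto_rpow_atTop hεd).comp tendsto_natCast_atTop_atTop)
  have hlim' : Tendsto (fun j => Real.exp 2 * L j ^ (s : ℝ)) atTop (𝓝 0) := by
    simpa [Real.zero_rpow hs'.ne'] using (hlim.rpow_const (Or.inr hs'.le)).const_mul (Real.exp 2)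
  obtain ⟨K, hK⟩ := eventually_atTop.1
    ((hlim.eventually (gt_mem_nhds (by norm_num : (0 : ℝ) < 1 / 2))).and
      (hlim'.eventually (gt_mem_nhds (by norm_num : (0 : ℝ) < 1 / 2))))
  obtain ⟨B, hB, hsum⟩ := sum_range_rpow_neg_le hθ hσ
  have hbound : ∀ N : ℕ, ∑ i ∈ Finset.range N, L i ^ (s : ℝ) ≤ C ^ (s : ℝ) * (B * (N : ℝ) ^ θ) := by
    intro N
    refine le_trans ?_ (mul_le_mul_of_nonneg_left (hsum N) (by positivity))
    rw [Finset.mul_sum]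
    refine Finset.sum_le_sum fun i _ => ?_
    rcases Nat.eq_zero_or_pos i with rfl | hi0
    · simp [hLdef, Real.zero_rpow hεd.ne', Real.zero_rpow hs'.ne']
    · rw [if_neg hi0.ne', mul_one, hLdef]
      simp only
      rw [Real.div_rpow hC.le (by positivity), ← Real.rpow_mul (by positivity), mul_one_div]
  have hstart : dimH {x | ∃ a : ℕ → ℕ+, IsDigitSeq f x a ∧ Monotone a ∧ (∀ n, K ≤ (a n : ℕ)) ∧
      ∀ δ > 0, ∃ᶠ n : ℕ in atTop, ((a n : ℕ) : ℝ) ^ θ ≤ δ * ((n : ℝ) + 1)} ≤ s := by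
    refine (dimH_mono ?_).trans (dimH_le_of_forall_digit_ge hf hL0 hL hs
      (fun j hj => (hK j hj).1.le) fun j hj => (hK j hj).2.le)
    rintro x ⟨a, hx, hmono, hKa, hfreq⟩
    have hA : 0 < 2 * Real.exp 2 * (C ^ (s : ℝ) * B) := by positivity
    refine ⟨a, hx, hmono, hKa, (hfreq _ (inv_pos.2 hA)).mono fun n hn => ?_⟩
    rw [inv_mul_eq_div, le_div_iff₀ hA] at hn
    calc _ ≤ 2 * Real.exp 2 * (C ^ (s : ℝ) * (B * ((a n : ℕ) : ℝ) ^ θ)) :=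
          mul_le_mul_of_nonneg_left (hbound _) (by positivity)
      _ = ((a n : ℕ) : ℝ) ^ θ * (2 * Real.exp 2 * (C ^ (s : ℝ) * B)) := by ring
      _ ≤ _ := hn
  have hall := dimH_le_of_eventually_digit_ge (φ := fun j => (j : ℝ) ^ θ) hf hstart
  refine (dimH_mono (t := {x | ∃ a : ℕ → ℕ+, IsDigitSeq f x a ∧ Monotone a ∧
    ∀ n, (a n : ℕ) < K} ∪ ⋃ q : ℕ, {x | ∃ a : ℕ → ℕ+, IsDigitSeq f x a ∧ Monotone a ∧
      (∀ n, q ≤ n → K ≤ (a n : ℕ)) ∧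
      ∀ δ > 0, ∃ᶠ n : ℕ in atTop, ((a n : ℕ) : ℝ) ^ θ ≤ δ * ((n : ℝ) + 1)}) ?_).trans ?_
  -- A non-decreasing sequence either stays below `K`, a countable case, or is at least `K` from
  -- some index `q` on.
  · rintro x ⟨a, hx, hmono, hfreq⟩
    by_cases h : ∃ q, K ≤ (a q : ℕ)
    · obtain ⟨q, hq⟩ := h
      exact Or.inr (mem_iUnion.2 ⟨q, a, hx, hmono, fun n hn => hq.trans (hmono hn), hfreq⟩)
    · exact Or.inl ⟨a, hx, hmono, by simpa using h⟩
  · rw [dimH_union, dimH_countable (countable_setOf_isDigitSeq_bounded f K), dimH_iUnion]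
    exact max_le zero_le (iSup_le hall)

/-! ### Relative position of the first-level cylinders. -/

namespace IsGaussLikeIIFS

variable {d : ℝ} {f : ℕ+ → ℝ → ℝ}

/-- The order hypothesis compares values at the same point only. If `f l u > f k v` with `u, v`
interior, then `f l v < f k v < f l u`, so by connectedness `f k v` lies in the open image of `f l`,
against disjointness. Endpoints follow by continuity. -/
theorem apply_le_apply (hf : IsGaussLikeIIFS d f) {k l : ℕ+} (hkl : k < l) {u v : ℝ}
    (hu : u ∈ Icc (0 : ℝ) 1) (hv : v ∈ Icc (0 : ℝ) 1) : f l u ≤ f k v := by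
  have hck := hf.toIsDecayingIIFS.continuousOn k
  have hcl := hf.toIsDecayingIIFS.continuousOn l
  have hIoo : ∀ u ∈ Ioo (0 : ℝ) 1, ∀ v ∈ Ioo (0 : ℝ) 1, f l u ≤ f k v := by
    intro u hu v hv
    by_contra! hlt
    have hvv := hf.order l k hkl v (Ioo_subset_Icc_self hv)
    have himage : IsPreconnected (f l '' Ioo 0 1) :=
      isPreconnected_Ioo.image _ (hcl.mono Ioo_subset_Icc_self)
    have hmem := himage.Icc_subset (mem_image_of_mem _ hv) (mem_image_of_mem _ hu)
      ⟨hvv.le, hlt.le⟩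
    exact (hf.openSet l k hkl.ne').le ⟨hmem, mem_image_of_mem _ hv⟩
  have hcl01 : closure (Ioo (0 : ℝ) 1) = Icc 0 1 := closure_Ioo zero_ne_one
  have hstep : ∀ u ∈ Icc (0 : ℝ) 1, ∀ v ∈ Ioo (0 : ℝ) 1, f l u ≤ f k v := by
    intro u hu v hv
    rw [← hcl01] at hu hcl
    exact le_on_closure (fun u hu => hIoo u hu v hv) hcl continuousOn_const hu
  rw [← hcl01] at hv hck
  exact le_on_closure (fun v hv => hstep u hu v hv) continuousOn_const hck hv

/-- The cylinder of `i + 1` lies between those of `i` and `j`, so its length separates them. -/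
theorem le_abs_sub_of_add_two_le (hf : IsGaussLikeIIFS d f) {ℓ : ℕ+ → ℝ}
    (hℓ : ∀ i, ∀ x ∈ Icc (0 : ℝ) 1, ∀ y ∈ Icc (0 : ℝ) 1, ℓ i * |x - y| ≤ |f i x - f i y|)
    {i j : ℕ+} (hij : i + 1 < j) {u v : ℝ} (hu : u ∈ Icc (0 : ℝ) 1) (hv : v ∈ Icc (0 : ℝ) 1) :
    ℓ (i + 1) ≤ |f i u - f j v| := by
  have h0 : (0 : ℝ) ∈ Icc (0 : ℝ) 1 := by simp
  have h1 : (1 : ℝ) ∈ Icc (0 : ℝ) 1 := by simp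
  have hi : i < i + 1 := PNat.lt_add_right i 1
  have h := hℓ (i + 1) 1 h1 0 h0
  rw [sub_zero, abs_one, mul_one] at h
  have a0 := hf.apply_le_apply hij hv h0
  have a1 := hf.apply_le_apply hij hv h1
  have b0 := hf.apply_le_apply hi h0 hu
  have b1 := hf.apply_le_apply hi h1 hu
  refine h.trans (le_trans ?_ (le_abs_self _))
  rw [abs_le]
  constructor <;> linarith

theorem _root_.IsDigitSeq.mem_Ioo (hf : IsGaussLikeIIFS d f) {a : ℕ → ℕ+} {x : ℝ}
    (h : IsDigitSeq f x a) (ha : 1 < a 0) : x ∈ Ioo (0 : ℝ) 1 := by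
  obtain ⟨u, hu, rfl⟩ : x ∈ f (a 0) '' Icc 0 1 := by
    simpa [cylinderMap] using h.mem_image_cylinderMap hf.toIsDecayingIIFS 1
  have hmem : f (a 0) u ∈ Ioc (0 : ℝ) 1 := by
    rw [← hf.cover]
    exact mem_iUnion.2 ⟨a 0, mem_image_of_mem _ hu⟩
  exact ⟨hmem.1, (hf.order _ _ ha u hu).trans_le (hf.mapsTo 1 hu).2⟩

end IsGaussLikeIIFS

/-! ### Lower bound: Cantor sets of digit blocks parametrized by mixed radix expansions. -/

/-- A map that expands at least like the inverse of a Hölder map has a large image. -/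
theorem le_dimH_image_of_abs_sub_le {φ : ℝ → ℝ} {D s : NNReal} (hs : 0 < s)
    (h : ∀ y ∈ Ico (0 : ℝ) 1, ∀ y' ∈ Ico (0 : ℝ) 1, |y - y'| ≤ D * |φ y - φ y'| ^ (s : ℝ)) :
    (s : ℝ≥0∞) ≤ dimH (φ '' Ico 0 1) := by
  have hs' : (s : ℝ) ≠ 0 := by exact_mod_cast hs.ne'
  have hinj : InjOn φ (Ico 0 1) := fun y hy y' hy' heq => by
    have := h y hy y' hy'
    rw [heq, sub_self, abs_zero, Real.zero_rpow hs', mul_zero] at this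
    exact sub_eq_zero.1 (abs_nonpos_iff.1 this)
  set g := Function.invFunOn φ (Ico 0 1) with hg
  have hleft : ∀ y ∈ Ico (0 : ℝ) 1, g (φ y) = y := fun y hy => hinj.leftInvOn_invFunOn hy
  have hHolder : HolderOnWith D s g (φ '' Ico 0 1) := by
    rintro _ ⟨y, hy, rfl⟩ _ ⟨y', hy', rfl⟩
    rw [hleft y hy, hleft y' hy', edist_dist, edist_dist, Real.dist_eq, Real.dist_eq,
      ENNReal.ofReal_rpow_of_nonneg (abs_nonneg _) s.coe_nonneg, ← ENNReal.ofReal_coe_nnreal,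
      ← ENNReal.ofReal_mul D.coe_nonneg]
    exact ENNReal.ofReal_le_ofReal (h y hy y' hy')
  have himage : g '' (φ '' Ico 0 1) = Ico 0 1 := by
    rw [image_image]
    exact (image_congr hleft).trans (image_id' _)
  have hdim := hHolder.dimH_image_le hs
  rw [himage, Real.dimH_of_nonempty_interior (by simp)] at hdim
  rw [ENNReal.le_div_iff_mul_le (by simp [hs.ne']) (by simp)] at hdim
  simpa using hdim

/-- The `n`-th digit of `y` in the mixed radix system with bases `m 0, m 1, …`. -/
noncomputable def mixedDigit (m : ℕ → ℕ) (y : ℝ) (n : ℕ) : ℕ :=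
  ⌊((∏ k ∈ Finset.range (n + 1), m k : ℕ) : ℝ) * y⌋₊ % m n

/-- Let `Q_n` be the product of the first `n` bases. Dividing `⌊Q_{k+1} y⌋` by `m k` gives `⌊Q_k y⌋`
with remainder the `k`-th digit, so the first `n` digits determine `⌊Q_n y⌋`. -/
theorem abs_sub_le_of_mixedDigit_eq {m : ℕ → ℕ} (hm : ∀ n, 0 < m n) {y y' : ℝ}
    (hy : y ∈ Ico (0 : ℝ) 1) (hy' : y' ∈ Ico (0 : ℝ) 1) {n : ℕ}
    (h : ∀ k < n, mixedDigit m y k = mixedDigit m y' k) :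
    |y - y'| ≤ ((∏ k ∈ Finset.range n, m k : ℕ) : ℝ)⁻¹ := by
  have hfloor : ⌊((∏ k ∈ Finset.range n, m k : ℕ) : ℝ) * y⌋₊ =
      ⌊((∏ k ∈ Finset.range n, m k : ℕ) : ℝ) * y'⌋₊ := by
    induction n with
    | zero => simp [Nat.floor_eq_zero.2 hy.2, Nat.floor_eq_zero.2 hy'.2]
    | succ n ih =>
      have hdiv : ∀ z : ℝ, ⌊((∏ k ∈ Finset.range (n + 1), m k : ℕ) : ℝ) * z⌋₊ / m n =
          ⌊((∏ k ∈ Finset.range n, m k : ℕ) : ℝ) * z⌋₊ := fun z => by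
        have : (m n : ℝ) ≠ 0 := by exact_mod_cast (hm n).ne'
        rw [← Nat.floor_div_natCast, Finset.prod_range_succ]
        congr 1
        push_cast
        field_simp
      have h1 := ih fun k hk => h k (hk.trans n.lt_succ_self)
      have h2 := h n n.lt_succ_self
      rw [← hdiv, ← hdiv] at h1
      rw [mixedDigit, mixedDigit] at h2
      rw [← Nat.div_add_mod ⌊((∏ k ∈ Finset.range (n + 1), m k : ℕ) : ℝ) * y⌋₊ (m n), h1, h2,
        Nat.div_add_mod]
  have hQ : (0 : ℝ) < ((∏ k ∈ Finset.range n, m k : ℕ) : ℝ) := by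
    exact_mod_cast Finset.prod_pos fun k _ => hm k
  set Q := ((∏ k ∈ Finset.range n, m k : ℕ) : ℝ)
  have a1 := Nat.floor_le (mul_nonneg hQ.le hy.1)
  have a2 := Nat.lt_floor_add_one (Q * y)
  have b1 := Nat.floor_le (mul_nonneg hQ.le hy'.1)
  have b2 := Nat.lt_floor_add_one (Q * y')
  rw [hfloor] at a1 a2
  rw [← one_div, le_div_iff₀ hQ, ← abs_of_pos hQ, ← abs_mul, abs_le]
  constructor <;> linarith

theorem exists_pos_le_of_eventually_le_succ {r : ℕ → ℝ} (hr : ∀ n, 0 < r n)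
    (h : ∀ᶠ n in atTop, r n ≤ r (n + 1)) : ∃ c > 0, ∀ n, c ≤ r n := by
  obtain ⟨N, hN⟩ := eventually_atTop.1 h
  obtain ⟨c, hc, hcN⟩ : ∃ c > 0, ∀ n ≤ N, c ≤ r n := by
    clear hN
    induction N with
    | zero => exact ⟨r 0, hr 0, fun n hn => by rw [Nat.le_zero.1 hn]⟩
    | succ N ih =>
      obtain ⟨c, hc, hcN⟩ := ih
      refine ⟨min c (r (N + 1)), lt_min hc (hr _), fun n hn => ?_⟩
      rcases Nat.le_succ_iff.1 hn with hn | rfl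
      · exact (min_le_left _ _).trans (hcN n hn)
      · exact min_le_right _ _
  refine ⟨c, hc, fun n => ?_⟩
  rcases le_total n N with hn | hn
  · exact hcN n hn
  · induction n, hn using Nat.le_induction with
    | base => exact hcN N le_rfl
    | succ n hn ih => exact ih.trans (hN n hn)

/-- If the digits of `y` and `y'` first differ at place `n`, then `|y - y'| ≤ 1 / Q n`, while the
coded points are at least `G n` apart. So `Q n * G n ^ s` must stay away from `0`; its successive
ratios are `C ^ s * m n / M (n + 2) ^ τ`, which tend to infinity. -/
theorem le_dimH_of_blocks {d : ℝ} {f : ℕ+ → ℝ → ℝ} (hf : IsGaussLikeIIFS d f) {M m : ℕ → ℕ}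
    (hM0 : 2 ≤ M 0) (hm : ∀ n, 0 < m n) (hM : ∀ n, M n + 2 * m n ≤ M (n + 1))
    {s : NNReal} (hs : 0 < s) {τ : ℝ} (hτ : s * d < τ)
    (h : Tendsto (fun n => (m n : ℝ) / (M (n + 2) : ℝ) ^ τ) atTop atTop) :
    (s : ℝ≥0∞) ≤ dimH {x | x ∈ Ioo (0 : ℝ) 1 ∧ ∃ a : ℕ → ℕ+, IsDigitSeq f x a ∧
      ∀ n, M n ≤ (a n : ℕ) ∧ (a n : ℕ) ≤ M (n + 1)} := by
  have hfd := hf.toIsDecayingIIFS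
  have hs' : (0 : ℝ) < s := by exact_mod_cast hs
  have hd := hf.one_lt_d
  have hMmono : StrictMono M := strictMono_nat_of_lt_succ fun n => by
    have := hM n
    have := hm n
    omega
  have hM2 : ∀ n, 2 ≤ M n := fun n => hM0.trans (hMmono.monotone n.zero_le)
  have hMpos : ∀ n, (0 : ℝ) < M n := fun n => by exact_mod_cast (two_pos.trans_le (hM2 n))
  -- With `ε = τ / s - d` the lower derivative bound has exponent `d + ε = τ / s`, so that `ℓ i ^ s
  -- = C ^ s / i ^ τ`.
  have hε : 0 < τ / s - d := by
    rw [sub_pos, lt_div_iff₀ hs']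
    linarith
  obtain ⟨C, hC, hlow⟩ := hfd.exists_le_abs_sub hε
  rw [add_sub_cancel] at hlow
  have hτs : 0 < τ / s := by linarith
  set ℓ : ℕ → ℝ := fun i => C / (i : ℝ) ^ (τ / s) with hℓ
  have hℓ0 : ∀ i, 0 ≤ ℓ i := fun i => by positivity
  have hℓM : ∀ n, 0 < ℓ (M n) := fun n => div_pos hC (Real.rpow_pos_of_pos (hMpos n) _)
  have hanti : ∀ i j : ℕ, 0 < i → i ≤ j → ℓ j ≤ ℓ i := fun i j hi hij => by
    have : (0 : ℝ) < i := by exact_mod_cast hi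
    simp only [hℓ]
    gcongr
  set Q : ℕ → ℕ := fun n => ∏ k ∈ Finset.range n, m k with hQ
  have hQpos : ∀ n, (0 : ℝ) < Q n := fun n => by
    exact_mod_cast Finset.prod_pos fun k _ => hm k
  set G : ℕ → ℝ := fun n => ∏ k ∈ Finset.range (n + 1), ℓ (M (k + 1)) with hG
  have hGpos : ∀ n, 0 < G n := fun n => Finset.prod_pos fun k _ => hℓM _
  obtain ⟨c, hc, hcr⟩ : ∃ c > 0, ∀ n, c ≤ (Q n : ℝ) * G n ^ (s : ℝ) := by
    refine exists_pos_le_of_eventually_le_succ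
      (fun n => mul_pos (hQpos n) (Real.rpow_pos_of_pos (hGpos n) _)) ?_
    filter_upwards [(h.const_mul_atTop (Real.rpow_pos_of_pos hC s)).eventually_ge_atTop 1]
      with n hn
    have h1 : G (n + 1) ^ (s : ℝ) = G n ^ (s : ℝ) * (C ^ (s : ℝ) / (M (n + 2) : ℝ) ^ τ) := by
      simp only [hG]
      rw [Finset.prod_range_succ, Real.mul_rpow (hGpos n).le (hℓ0 _)]
      congr 1
      simp only [hℓ]
      rw [Real.div_rpow hC.le (by positivity), ← Real.rpow_mul (by positivity),
        div_mul_cancel₀ _ hs'.ne']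
    have h2 : (Q (n + 1) : ℝ) = Q n * m n := by
      simp only [hQ]
      rw [Finset.prod_range_succ]
      push_cast
      rfl
    rw [h1, h2]
    calc (Q n : ℝ) * G n ^ (s : ℝ)
        ≤ (Q n : ℝ) * G n ^ (s : ℝ) * (C ^ (s : ℝ) * (m n / (M (n + 2) : ℝ) ^ τ)) :=
          le_mul_of_one_le_right
            (mul_pos (hQpos n) (Real.rpow_pos_of_pos (hGpos n) _)).le hn
      _ = _ := by ring
  have hm_lim : Tendsto (fun n => (m n : ℝ)) atTop atTop := by
    refine tendsto_atTop_mono (fun n => ?_) h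
    refine div_le_self (Nat.cast_nonneg _) (Real.one_le_rpow ?_ (by nlinarith))
    exact_mod_cast one_le_two.trans (hM2 _)
  have hQ_lim : Tendsto (fun n => ((Q n : ℝ))⁻¹) atTop (𝓝 0) := by
    refine tendsto_inv_atTop_zero.comp ((tendsto_add_atTop_iff_nat 1).1
      (tendsto_atTop_mono (fun n => ?_) hm_lim))
    have : m n ≤ Q (n + 1) := by
      simp only [hQ]
      rw [Finset.prod_range_succ]
      exact Nat.le_mul_of_pos_left _ (Finset.prod_pos fun k _ => hm k)
    exact_mod_cast this
  -- The factor `2` leaves an unused letter between any two used ones; its cylinder provides the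
  -- gap.
  let a : ℝ → ℕ → ℕ+ := fun y n => ⟨M n + 2 * mixedDigit m y n, by have := hM2 n; omega⟩
  have ha : ∀ y n, (a y n : ℕ) = M n + 2 * mixedDigit m y n := fun y n => rfl
  have halt : ∀ y n, (a y n : ℕ) + 2 ≤ M (n + 1) := fun y n => by
    have := Nat.mod_lt ⌊((∏ k ∈ Finset.range (n + 1), m k : ℕ) : ℝ) * y⌋₊ (hm n)
    rw [← mixedDigit] at this
    have := hM n
    rw [ha]
    omega
  have hex : ∀ y, ∃ x, IsDigitSeq f x (a y) := fun y => by
    obtain ⟨x, -, hx⟩ := hfd.exists_isDigitSeq (a := a y)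
      (tendsto_atTop_mono (fun n => by rw [ha]; omega) hMmono.tendsto_atTop)
    exact ⟨x, hx⟩
  choose φ hφ using hex
  have hgap : ∀ (y y' : ℝ) (n : ℕ), (∀ k < n, mixedDigit m y k = mixedDigit m y' k) →
      mixedDigit m y n < mixedDigit m y' n → G n ≤ |φ y - φ y'| := by
    intro y y' n hk hn
    obtain ⟨u, hu, hxu⟩ := (hφ y).mem_image_cylinderMap hfd (n + 1)
    obtain ⟨v, hv, hxv⟩ := (hφ y').mem_image_cylinderMap hfd (n + 1)
    have hcongr : cylinderMap f (a y') n = cylinderMap f (a y) n :=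
      cylinderMap_congr fun k hkn => PNat.eq (by rw [ha, ha, hk k hkn])
    rw [cylinderMap, Function.comp] at hxu hxv
    rw [hcongr] at hxv
    have h1 : (a y n + 1 : ℕ+) < a y' n := by
      rw [← PNat.coe_lt_coe, PNat.add_coe, ha, ha, PNat.one_coe]
      omega
    have h2 := hf.le_abs_sub_of_add_two_le (ℓ := fun i => ℓ i) hlow h1 hu hv
    rw [← hxu, ← hxv]
    refine le_trans ?_ (le_abs_cylinderMap_sub hf.mapsTo (L := fun i => ℓ i) (fun i => hℓ0 i)
      hlow (a y) n (hf.mapsTo _ hu) (hf.mapsTo _ hv))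
    simp only [hG]
    rw [Finset.prod_range_succ]
    refine mul_le_mul (Finset.prod_le_prod (fun k _ => hℓ0 _) fun k _ => ?_) ?_ (hℓ0 _)
      (Finset.prod_nonneg fun k _ => hℓ0 _)
    · exact hanti _ _ (a y k).pos (by have := halt y k; omega)
    · refine (hanti _ _ (a y n + 1).pos ?_).trans h2
      have := halt y n
      rw [PNat.add_coe, PNat.one_coe]
      omega
  have hmain : ∀ y ∈ Ico (0 : ℝ) 1, ∀ y' ∈ Ico (0 : ℝ) 1,
      |y - y'| ≤ (c⁻¹.toNNReal : ℝ) * |φ y - φ y'| ^ (s : ℝ) := by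
    intro y hy y' hy'
    rw [Real.coe_toNNReal _ (inv_nonneg.2 hc.le)]
    by_cases hall : ∀ n, mixedDigit m y n = mixedDigit m y' n
    · have : |y - y'| ≤ 0 := ge_of_tendsto' hQ_lim fun n =>
        abs_sub_le_of_mixedDigit_eq hm hy hy' fun k _ => hall k
      exact this.trans (by positivity)
    · push Not at hall
      classical
      have hmin : ∀ k < Nat.find hall, mixedDigit m y k = mixedDigit m y' k := fun k hk =>
        not_not.1 (Nat.find_min hall hk)
      have hspec := Nat.find_spec hall
      set n := Nat.find hall
      have hGn : G n ≤ |φ y - φ y'| := by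
        rcases lt_or_gt_of_ne hspec with hlt | hlt
        · exact hgap y y' n hmin hlt
        · rw [abs_sub_comm]
          exact hgap y' y n (fun k hk => (hmin k hk).symm) hlt
      calc |y - y'| ≤ ((Q n : ℝ))⁻¹ := abs_sub_le_of_mixedDigit_eq hm hy hy' hmin
        _ ≤ c⁻¹ * G n ^ (s : ℝ) := by
            rw [inv_mul_eq_div, le_div_iff₀ hc, inv_mul_le_iff₀ (hQpos n)]
            exact hcr n
        _ ≤ _ := by
            gcongr
  refine (le_dimH_image_of_abs_sub_le hs hmain).trans (dimH_mono ?_)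
  rintro _ ⟨y, -, rfl⟩
  refine ⟨(hφ y).mem_Ioo hf ?_, a y, hφ y, fun n => ⟨by rw [ha]; omega,
    by have := halt y n; omega⟩⟩
  rw [← PNat.coe_lt_coe, ha, PNat.one_coe]
  omega

/-! ### Growth ratio against growth of the digits. -/

section Growth

variable {m : ℕ} {t : Fin (m + 1) → ℝ} {a : ℕ → ℕ+}

theorem log_prod_digits (t : Fin (m + 1) → ℝ) (a : ℕ → ℕ+) (n : ℕ) :
    Real.log (∏ i : Fin (m + 1), ((a (n + i) : ℕ) : ℝ) ^ t i) =
      ∑ i : Fin (m + 1), t i * Real.log ((a (n + i) : ℕ) : ℝ) := by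
  have hpos : ∀ k, (0 : ℝ) < ((a k : ℕ) : ℝ) := fun k => by exact_mod_cast (a k).pos
  rw [Real.log_prod fun i _ => (Real.rpow_pos_of_pos (hpos _) _).ne']
  exact Finset.sum_congr rfl fun i _ => Real.log_rpow (hpos _) _

theorem sum_mul_log_le_log_prod (ht : ∀ i, 0 ≤ t i) (ha : Monotone a) (n : ℕ) :
    (∑ i, t i) * Real.log ((a n : ℕ) : ℝ) ≤
      Real.log (∏ i : Fin (m + 1), ((a (n + i) : ℕ) : ℝ) ^ t i) := by
  rw [log_prod_digits, Finset.sum_mul]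
  refine Finset.sum_le_sum fun i _ => mul_le_mul_of_nonneg_left (Real.log_le_log ?_ ?_) (ht i)
  · exact_mod_cast (a n).pos
  · exact_mod_cast ha (Nat.le_add_right n i)

theorem log_prod_le_sum_mul_log (ht : ∀ i, 0 ≤ t i) (ha : Monotone a) (n : ℕ) :
    Real.log (∏ i : Fin (m + 1), ((a (n + i) : ℕ) : ℝ) ^ t i) ≤
      (∑ i, t i) * Real.log ((a (n + m) : ℕ) : ℝ) := by
  rw [log_prod_digits, Finset.sum_mul]
  refine Finset.sum_le_sum fun i _ => mul_le_mul_of_nonneg_left (Real.log_le_log ?_ ?_) (ht i)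
  · exact_mod_cast (a _).pos
  · exact_mod_cast ha (Nat.add_le_add_left (Nat.lt_succ_iff.1 i.2) n)

theorem tendsto_log_natCast_add_one : Tendsto (fun n : ℕ => Real.log ((n : ℝ) + 1)) atTop atTop :=
  Real.tendsto_log_atTop.comp (tendsto_atTop_add_const_right _ _ tendsto_natCast_atTop_atTop)

theorem tendsto_growthRatio_of_bounds (ht : ∀ i, 0 ≤ t i) (ha : Monotone a) {β A : ℝ}
    (hβ : 0 ≤ β) (hA : 0 < A) (hlow : ∀ n : ℕ, ((n : ℝ) + 1) ^ β ≤ (a n : ℕ))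
    (hup : ∀ n : ℕ, ((a n : ℕ) : ℝ) ≤ A * ((n : ℝ) + 2) ^ β) :
    Tendsto (growthRatio t a) atTop (𝓝 (((∑ i, t i) * β : ℝ) : EReal)) := by
  have hT : 0 ≤ ∑ i, t i := Finset.sum_nonneg fun i _ => ht i
  refine EReal.tendsto_coe.2 ?_
  have hlim : Tendsto (fun n : ℕ => (∑ i, t i) * β +
      (∑ i, t i) * (Real.log A + β * Real.log (m + 2)) / Real.log ((n : ℝ) + 1)) atTop
      (𝓝 ((∑ i, t i) * β)) := by
    simpa using (tendsto_log_natCast_add_one.const_div_atTop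
      ((∑ i, t i) * (Real.log A + β * Real.log (m + 2)))).const_add ((∑ i, t i) * β)
  refine tendsto_of_tendsto_of_tendsto_of_le_of_le' tendsto_const_nhds hlim ?_ ?_
  · filter_upwards [eventually_ge_atTop 1] with n hn
    have hn' : (1 : ℝ) ≤ n := by exact_mod_cast hn
    have hlog : 0 < Real.log ((n : ℝ) + 1) := Real.log_pos (by linarith)
    rw [le_div_iff₀ hlog, mul_assoc]
    refine le_trans (mul_le_mul_of_nonneg_left ?_ hT) (sum_mul_log_le_log_prod ht ha n)
    rw [← Real.log_rpow (by linarith)]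
    exact Real.log_le_log (by positivity) (hlow n)
  · filter_upwards [eventually_ge_atTop 1] with n hn
    have hn' : (1 : ℝ) ≤ n := by exact_mod_cast hn
    have hlog : 0 < Real.log ((n : ℝ) + 1) := Real.log_pos (by linarith)
    rw [div_le_iff₀ hlog, add_mul, div_mul_cancel₀ _ hlog.ne', mul_assoc, ← mul_add]
    refine (log_prod_le_sum_mul_log ht ha n).trans (mul_le_mul_of_nonneg_left ?_ hT)
    -- Here `n + m + 2 ≤ (m + 2)(n + 1)`, so the shift by `m` costs only a constant factor.
    have h1 : ((a (n + m) : ℕ) : ℝ) ≤ A * (((m : ℝ) + 2) * ((n : ℝ) + 1)) ^ β := by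
      refine (hup _).trans ?_
      gcongr
      push_cast
      nlinarith [mul_nonneg (Nat.cast_nonneg (α := ℝ) m) (Nat.cast_nonneg (α := ℝ) n)]
    have h2 := Real.log_le_log (by exact_mod_cast (a (n + m)).pos) h1
    rw [Real.log_mul hA.ne' (by positivity), Real.log_rpow (by positivity),
      Real.log_mul (by positivity) (by positivity)] at h2
    linarith

theorem tendsto_growthRatio_top (ht : ∀ i, 0 ≤ t i) (hT : 0 < ∑ i, t i) (ha : Monotone a)
    (hlow : ∀ n : ℕ, 2 ^ (n + 1) ≤ (a n : ℕ)) : Tendsto (growthRatio t a) atTop (𝓝 ⊤) := by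
  refine EReal.tendsto_coe_nhds_top_iff.2 ?_
  have h1 : Tendsto (fun n : ℕ => ((n : ℝ) + 1) / Real.log ((n : ℝ) + 1)) atTop atTop := by
    have h := (Real.isLittleO_log_id_atTop.comp_tendsto (tendsto_atTop_add_const_right _ (1 : ℝ)
      tendsto_natCast_atTop_atTop)).tendsto_div_nhds_zero
    have h0 : Tendsto (fun n : ℕ => Real.log ((n : ℝ) + 1) / ((n : ℝ) + 1)) atTop (𝓝[>] 0) := by
      refine tendsto_nhdsWithin_iff.2 ⟨h, ?_⟩
      filter_upwards [eventually_ge_atTop 1] with n hn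
      have hn' : (1 : ℝ) ≤ n := by exact_mod_cast hn
      exact div_pos (Real.log_pos (by linarith)) (by linarith)
    exact h0.inv_tendsto_nhdsGT_zero.congr fun n => inv_div _ _
  refine tendsto_atTop_mono' _ ?_ (h1.const_mul_atTop (mul_pos hT (Real.log_pos one_lt_two)))
  filter_upwards [eventually_ge_atTop 1] with n hn
  have hn' : (1 : ℝ) ≤ n := by exact_mod_cast hn
  have hlog : 0 < Real.log ((n : ℝ) + 1) := Real.log_pos (by linarith)
  rw [← mul_div_assoc]
  refine div_le_div_of_nonneg_right (le_trans ?_ (sum_mul_log_le_log_prod ht ha n)) hlog.le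
  rw [mul_assoc]
  refine mul_le_mul_of_nonneg_left ?_ hT.le
  have h2 : ((2 : ℝ) ^ (n + 1)) ≤ (a n : ℕ) := by exact_mod_cast hlow n
  have h3 := Real.log_le_log (by positivity) h2
  rw [Real.log_pow] at h3
  push_cast at h3
  linarith

/-- For `c` slightly above `b / T`, infinitely many `n` satisfy `a n ≤ (n + 1) ^ c`; since `θ c <
1`, `(n + 1) ^ (θ c)` is eventually below `δ (n + 1)`. -/
theorem frequently_digit_rpow_le (ht : ∀ i, 0 ≤ t i) (hT : 0 < ∑ i, t i) (ha : Monotone a)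
    {b θ : ℝ} (hθ : 0 ≤ θ) (hb : 0 ≤ b) (hθb : θ * (b / ∑ i, t i) < 1)
    (h : liminf (growthRatio t a) atTop ≤ (b : EReal)) {δ : ℝ} (hδ : 0 < δ) :
    ∃ᶠ n : ℕ in atTop, ((a n : ℕ) : ℝ) ^ θ ≤ δ * ((n : ℝ) + 1) := by
  set T := ∑ i, t i
  obtain ⟨c, hbc, hc⟩ : ∃ c, b / T < c ∧ θ * c < 1 := by
    rcases hθ.eq_or_lt with rfl | hθ
    · exact ⟨b / T + 1, by linarith, by simp⟩
    · obtain ⟨c, h1, h2⟩ := exists_between ((lt_div_iff₀' hθ).2 hθb)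
      exact ⟨c, h1, (lt_div_iff₀' hθ).1 h2⟩
  have hc0 : 0 ≤ c := (div_nonneg hb hT.le).trans hbc.le
  have hlt : liminf (growthRatio t a) atTop < ((c * T : ℝ) : EReal) :=
    h.trans_lt (EReal.coe_lt_coe_iff.2 ((div_lt_iff₀ hT).1 hbc))
  have hgrow : ∀ᶠ n : ℕ in atTop, δ⁻¹ ≤ ((n : ℝ) + 1) ^ (1 - θ * c) :=
    ((tendsto_rpow_atTop (by linarith)).comp (tendsto_atTop_add_const_right _ (1 : ℝ)
      tendsto_natCast_atTop_atTop)).eventually_ge_atTop _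
  refine ((frequently_lt_of_liminf_lt (by isBoundedDefault) hlt).and_eventually
    (hgrow.and (eventually_ge_atTop 1))).mono ?_
  rintro n ⟨hn, hδn, hn1⟩
  have hn' : (1 : ℝ) ≤ n := by exact_mod_cast hn1
  have hx : (0 : ℝ) < (n : ℝ) + 1 := by linarith
  have hlog : 0 < Real.log ((n : ℝ) + 1) := Real.log_pos (by linarith)
  have hapos : (0 : ℝ) < (a n : ℕ) := by exact_mod_cast (a n).pos
  rw [growthRatio, EReal.coe_lt_coe_iff, div_lt_iff₀ hlog] at hn
  have h1 : T * Real.log (a n : ℕ) ≤ T * (c * Real.log ((n : ℝ) + 1)) := by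
    linarith [sum_mul_log_le_log_prod ht ha n]
  have h2 := le_of_mul_le_mul_left h1 hT
  rw [← Real.log_rpow hx, Real.log_le_log_iff hapos (by positivity)] at h2
  have h3 := Real.rpow_le_rpow hapos.le h2 hθ
  rw [← Real.rpow_mul hx.le] at h3
  refine h3.trans ?_
  rw [inv_le_iff_one_le_mul₀ hδ] at hδn
  calc ((n : ℝ) + 1) ^ (c * θ) ≤ ((n : ℝ) + 1) ^ (c * θ) * (((n : ℝ) + 1) ^ (1 - θ * c) * δ) :=
        le_mul_of_one_le_right (by positivity) hδn
    _ = δ * ((n : ℝ) + 1) := by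
        rw [← mul_assoc, ← Real.rpow_add hx, show c * θ + (1 - θ * c) = 1 by ring, Real.rpow_one,
          mul_comm]

end Growth

theorem ENNReal.le_of_forall_lt_le_of_forall_gt_le {A B : ℝ≥0∞} (κ : NNReal)
    (hA : ∀ s : NNReal, κ < s → A ≤ s) (hB : ∀ s : NNReal, 0 < s → s < κ → (s : ℝ≥0∞) ≤ B) :
    A ≤ B := by
  have h1 : A ≤ κ := ENNReal.le_of_forall_pos_le_add fun ε hε _ => by
    have := hA (κ + ε) (lt_add_of_pos_right _ hε)
    exact_mod_cast this
  refine h1.trans (ENNReal.le_of_forall_nnreal_lt fun s hs => ?_)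
  rcases eq_or_lt_of_le (zero_le : 0 ≤ s) with rfl | hs0
  · simp
  · exact hB s hs0 (by exact_mod_cast hs)

theorem rpow_add_rpow_sub_one_le {x β : ℝ} (hx : 0 < x) (hβ : 1 ≤ β) :
    x ^ β + x ^ (β - 1) ≤ (x + 1) ^ β := by
  have h1 : ∀ y : ℝ, 0 < y → y ^ β = y * y ^ (β - 1) := fun y hy => by
    rw [Real.rpow_sub_one hy.ne', mul_div_cancel₀ _ hy.ne']
  have h2 : x ^ (β - 1) ≤ (x + 1) ^ (β - 1) :=
    Real.rpow_le_rpow hx.le (by linarith) (by linarith)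
  rw [h1 x hx, h1 (x + 1) (by linarith)]
  nlinarith

/-! ### Dimension of the level sets. -/

section LevelSets

variable {d : ℝ} {f : ℕ+ → ℝ → ℝ} {m : ℕ} {t : Fin (m + 1) → ℝ}

theorem le_dimH_limSet_coe (hf : IsGaussLikeIIFS d f) (ht : ∀ i, 0 ≤ t i)
    {β : ℝ} (hβ : 1 < β) {α : ℝ≥0∞} (hα : (α : EReal) = (((∑ i, t i) * β : ℝ) : EReal))
    {s : NNReal} (hs : 0 < s) (hsβ : s * d < (β - 1) / β) : (s : ℝ≥0∞) ≤ dimH (limSet f t α) := by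
  obtain ⟨τ, hsτ, hτβ⟩ := exists_between hsβ
  have hs' : (0 : ℝ) < s := by exact_mod_cast hs
  have hτ0 : 0 < τ := lt_trans (mul_pos hs' (by linarith [hf.one_lt_d])) hsτ
  rw [lt_div_iff₀ (by linarith)] at hτβ
  -- With `x = n + 1`, the factor `4` makes room `4 x^(β-1)` between blocks: `2 b n` takes at most
  -- `2 x^(β-1)` and rounding up at most `1 ≤ x^(β-1)`.
  set M : ℕ → ℕ := fun n => ⌈4 * ((n : ℝ) + 1) ^ β⌉₊ with hM
  set b : ℕ → ℕ := fun n => ⌊((n : ℝ) + 1) ^ (β - 1)⌋₊ with hb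
  have hx : ∀ n : ℕ, (1 : ℝ) ≤ (n : ℝ) + 1 := fun n => by
    linarith [Nat.cast_nonneg (α := ℝ) n]
  have hx1 : ∀ n : ℕ, (1 : ℝ) ≤ ((n : ℝ) + 1) ^ β := fun n =>
    Real.one_le_rpow (hx n) (by linarith)
  have hx2 : ∀ n : ℕ, (1 : ℝ) ≤ ((n : ℝ) + 1) ^ (β - 1) := fun n =>
    Real.one_le_rpow (hx n) (by linarith)
  have hMlow : ∀ n : ℕ, 4 * ((n : ℝ) + 1) ^ β ≤ M n := fun n => Nat.le_ceil _
  have hMup : ∀ n : ℕ, (M n : ℝ) < 4 * ((n : ℝ) + 1) ^ β + 1 := fun n =>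
    Nat.ceil_lt_add_one (by positivity)
  have hM5 : ∀ n : ℕ, (M n : ℝ) ≤ 5 * ((n : ℝ) + 1) ^ β := fun n => by
    linarith [hMup n, hx1 n]
  have hM0 : 2 ≤ M 0 := by
    have := hMlow 0
    norm_num at this
    omega
  have hblow : ∀ n : ℕ, ((n : ℝ) + 1) ^ (β - 1) / 2 ≤ b n := fun n => by
    have h1 := Nat.lt_floor_add_one (((n : ℝ) + 1) ^ (β - 1))
    have h2 : (1 : ℝ) ≤ b n := by exact_mod_cast Nat.le_floor (by exact_mod_cast hx2 n)
    linarith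
  have hbpos : ∀ n, 0 < b n := fun n => Nat.floor_pos.2 (hx2 n)
  have hstep : ∀ n, M n + 2 * b n ≤ M (n + 1) := fun n => by
    have h1 : (b n : ℝ) ≤ ((n : ℝ) + 1) ^ (β - 1) := Nat.floor_le (by positivity)
    have h2 := rpow_add_rpow_sub_one_le (zero_lt_one.trans_le (hx n)) hβ.le
    have h3 := hMlow (n + 1)
    push_cast at h3
    have h4 : (M n : ℝ) + 2 * b n ≤ M (n + 1) := by linarith [hMup n, hx2 n]
    exact_mod_cast h4
  have hlim : Tendsto (fun n => (b n : ℝ) / (M (n + 2) : ℝ) ^ τ) atTop atTop := by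
    -- The exponent `β - 1 - β τ` is positive precisely because `τ < (β - 1) / β`.
    have h1 : Tendsto (fun n : ℕ => (1 / 2 / (5 * (3 : ℝ) ^ β) ^ τ) *
        ((n : ℝ) + 1) ^ (β - 1 - β * τ)) atTop atTop :=
      ((tendsto_rpow_atTop (by linarith)).comp (tendsto_atTop_add_const_right _ (1 : ℝ)
        tendsto_natCast_atTop_atTop)).const_mul_atTop (by positivity)
    refine tendsto_atTop_mono (fun n => ?_) h1
    have hxp : (0 : ℝ) < (n : ℝ) + 1 := zero_lt_one.trans_le (hx n)
    have h2 : (M (n + 2) : ℝ) ≤ 5 * (3 : ℝ) ^ β * ((n : ℝ) + 1) ^ β := by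
      refine (hM5 _).trans ?_
      rw [mul_assoc, ← Real.mul_rpow (by norm_num) hxp.le]
      gcongr
      push_cast
      linarith [Nat.cast_nonneg (α := ℝ) n]
    have h3 : (M (n + 2) : ℝ) ^ τ ≤ (5 * (3 : ℝ) ^ β) ^ τ * ((n : ℝ) + 1) ^ (β * τ) := by
      rw [Real.rpow_mul hxp.le, ← Real.mul_rpow (by positivity) (by positivity)]
      exact Real.rpow_le_rpow (Nat.cast_nonneg _) h2 hτ0.le
    have hMp : (0 : ℝ) < M (n + 2) := lt_of_lt_of_le (by positivity) (hMlow (n + 2))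
    calc _ = ((n : ℝ) + 1) ^ (β - 1) / 2 / ((5 * (3 : ℝ) ^ β) ^ τ * ((n : ℝ) + 1) ^ (β * τ)) := by
          rw [Real.rpow_sub hxp]
          field_simp
      _ ≤ _ := by
          gcongr
          exact hblow n
  refine (le_dimH_of_blocks hf hM0 hbpos hstep hs hsτ hlim).trans (dimH_mono ?_)
  rintro x ⟨hx01, a, hxa, ha⟩
  have hmono : Monotone a := monotone_nat_of_le_succ fun n =>
    PNat.coe_le_coe _ _ |>.1 ((ha n).2.trans (ha (n + 1)).1)
  refine ⟨hx01, a, hxa, fun n => hmono n.le_succ, ?_⟩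
  rw [hα]
  refine tendsto_growthRatio_of_bounds ht hmono (A := 5) (by linarith) (by norm_num)
    (fun n => ?_) fun n => ?_
  · have : (M n : ℝ) ≤ (a n : ℕ) := by exact_mod_cast (ha n).1
    linarith [hMlow n, hx1 n]
  · have h1 : ((a n : ℕ) : ℝ) ≤ M (n + 1) := by exact_mod_cast (ha n).2
    have h2 := hM5 (n + 1)
    push_cast at h2
    rw [add_assoc, one_add_one_eq_two] at h2
    exact h1.trans h2

theorem le_dimH_limSet_top (hf : IsGaussLikeIIFS d f) (ht : ∀ i, 0 ≤ t i) (hT : 0 < ∑ i, t i)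
    {s : NNReal} (hs : 0 < s) (hsd : s * d < 1) : (s : ℝ≥0∞) ≤ dimH (limSet f t ⊤) := by
  obtain ⟨τ, hsτ, hτ⟩ := exists_between hsd
  -- The quotient is `2 ^ (n (1 - τ) - 4 τ)`, and `τ < 1`.
  have hlim : Tendsto (fun n : ℕ => ((2 ^ n : ℕ) : ℝ) / ((2 ^ (n + 2 + 2) : ℕ) : ℝ) ^ τ)
      atTop atTop := by
    have h1 : Tendsto (fun n : ℕ => ((2 : ℝ) ^ (4 * τ))⁻¹ * ((2 : ℝ) ^ (1 - τ)) ^ n) atTop atTop :=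
      (tendsto_pow_atTop_atTop_of_one_lt
        (Real.one_lt_rpow one_lt_two (by linarith))).const_mul_atTop (by positivity)
    refine h1.congr fun n => ?_
    push_cast
    rw [← Real.rpow_natCast, ← Real.rpow_natCast, ← Real.rpow_natCast, ← Real.rpow_mul (by norm_num),
      ← Real.rpow_mul (by norm_num), ← Real.rpow_neg (by norm_num), ← Real.rpow_add (by norm_num),
      ← Real.rpow_sub (by norm_num)]
    congr 1
    push_cast
    ring
  refine (le_dimH_of_blocks hf (M := fun n => 2 ^ (n + 2)) (m := fun n => 2 ^ n) (by norm_num)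
    (fun n => by positivity) (fun n => ?_) hs hsτ hlim).trans (dimH_mono ?_)
  · simp only [pow_succ]
    omega
  · rintro x ⟨hx01, a, hxa, ha⟩
    have hmono : Monotone a := monotone_nat_of_le_succ fun n =>
      PNat.coe_le_coe _ _ |>.1 ((ha n).2.trans (ha (n + 1)).1)
    refine ⟨hx01, a, hxa, fun n => hmono n.le_succ, ?_⟩
    rw [EReal.coe_ennreal_top]
    exact tendsto_growthRatio_top ht hT hmono fun n =>
      (Nat.pow_le_pow_right two_pos (by omega)).trans (ha n).1

theorem dimH_liminf_le_dimH_limSet (hf : IsGaussLikeIIFS d f) (ht : ∀ i, 0 ≤ t i)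
    (hT : 0 < ∑ i, t i) (α : ℝ≥0∞) :
    dimH (monotoneDigitSet f fun a => liminf (growthRatio t a) atTop ≤ (α : EReal)) ≤
      dimH (limSet f t α) := by
  have hd : 0 < d := zero_lt_one.trans hf.one_lt_d
  have hupper : ∀ {s : NNReal} {θ : ℝ}, 0 < s → 0 ≤ θ → 1 - θ < s * d →
      (∀ a : ℕ → ℕ+, Monotone a → liminf (growthRatio t a) atTop ≤ (α : EReal) →
        ∀ δ > 0, ∃ᶠ n : ℕ in atTop, ((a n : ℕ) : ℝ) ^ θ ≤ δ * ((n : ℝ) + 1)) →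
      dimH (monotoneDigitSet f fun a => liminf (growthRatio t a) atTop ≤ (α : EReal)) ≤ s :=
    fun hs hθ hsd h => (dimH_mono (by
      rintro x ⟨_, a, hxa, hmono, hlim⟩
      exact ⟨a, hxa, monotone_nat_of_le_succ hmono, h a (monotone_nat_of_le_succ hmono) hlim⟩)).trans
        (dimH_le_of_frequently_digit_le hf.toIsDecayingIIFS hs hθ hsd)
  induction α with
  | top =>
    refine ENNReal.le_of_forall_lt_le_of_forall_gt_le (1 / d).toNNReal (fun s hs => ?_)
      fun s hs0 hs => ?_
    · rw [Real.toNNReal_lt_iff_lt_coe (by positivity), div_lt_iff₀ hd] at hs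
      have hs0 : (0 : ℝ) < s := by
        by_contra! h
        nlinarith
      -- With `θ = 0` the digit condition reads `1 ≤ δ (n + 1)`, which holds for all large `n`.
      refine hupper (θ := 0) (by exact_mod_cast hs0) le_rfl (by linarith) fun a _ _ δ hδ => ?_
      have hlim : Tendsto (fun n : ℕ => δ * ((n : ℝ) + 1)) atTop atTop :=
        (tendsto_atTop_add_const_right _ _ tendsto_natCast_atTop_atTop).const_mul_atTop hδ
      simpa using (hlim.eventually_ge_atTop 1).frequently
    · rw [Real.lt_toNNReal_iff_coe_lt, lt_div_iff₀ hd] at hs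
      exact le_dimH_limSet_top hf ht hT hs0 hs
  | coe b =>
    set T := ∑ i, t i with hTdef
    have hb : (((b : ℝ≥0∞) : EReal)) = ((b : ℝ) : EReal) := rfl
    have hβ0 : 0 ≤ (b : ℝ) / T := by positivity
    -- The critical value `(1 - 1/β) / d`: `toNNReal` truncates it to `0` for `β ≤ 1`, and for `β =
    -- 0` division by zero gives `0` as well.
    refine ENNReal.le_of_forall_lt_le_of_forall_gt_le
      (((b : ℝ) / T - 1) / (b / T) / d).toNNReal (fun s hs => ?_) fun s hs0 hs => ?_
    · have hs0 : 0 < s := zero_le.trans_lt hs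
      have hs0' : (0 : ℝ) < s := by exact_mod_cast hs0
      replace hs := (Real.le_coe_toNNReal _).trans_lt (NNReal.coe_lt_coe.2 hs)
      rw [div_lt_iff₀ hd] at hs
      obtain ⟨θ, hθ, hsθ, hθb⟩ : ∃ θ : ℝ, 0 ≤ θ ∧ 1 - θ < s * d ∧ θ * ((b : ℝ) / T) < 1 := by
        -- For `β = 0` the choice `θ = 1` works; otherwise `θ` lies between `max 0 (1 - s d)` and `1
        -- / β`.
        rcases hβ0.eq_or_lt with h | h
        · exact ⟨1, zero_le_one, by simpa using mul_pos hs0' hd, by rw [← h]; norm_num⟩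
        · rw [sub_div, div_self h.ne'] at hs
          obtain ⟨θ, h1, h2⟩ := exists_between (max_lt (one_div_pos.2 h)
            (by linarith : 1 - s * d < 1 / ((b : ℝ) / T)))
          exact ⟨θ, (le_max_left _ _).trans h1.le, by linarith [(le_max_right _ _).trans_lt h1],
            (lt_div_iff₀ h).1 h2⟩
      exact hupper hs0 hθ hsθ fun a ha hlim δ hδ =>
        frequently_digit_rpow_le ht hT ha hθ b.2 hθb hlim hδ
    · rw [Real.lt_toNNReal_iff_coe_lt, lt_div_iff₀ hd] at hs
      have hs0' : (0 : ℝ) < s := by exact_mod_cast hs0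
      have hβ : 1 < (b : ℝ) / T := by
        by_contra! h
        have := div_nonpos_of_nonpos_of_nonneg (sub_nonpos.2 h) hβ0
        nlinarith [mul_pos hs0' hd]
      exact le_dimH_limSet_coe hf ht hβ (by rw [hb, ← hTdef, mul_div_cancel₀ _ hT.ne']) hs0 hs

end LevelSets

theorem theorem1p5 (d : ℝ) (f : ℕ+ → ℝ → ℝ) (hf : IsGaussLikeIIFS d f)
    (m : ℕ) (hm : 1 ≤ m) (t : Fin (m + 1) → ℝ) (ht : ∀ i, 0 ≤ t i)
    (ht0 : t 0 ≠ 0) (ht1 : ∃ i, i ≠ 0 ∧ t i ≠ 0) (α : ℝ≥0∞) :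
    dimH (limSet f t α) = dimH (limsupSet f t α) ∧
      dimH (limsupSet f t α) = dimH (liminfSet f t α) := by
  have hT : 0 < ∑ i, t i := Finset.sum_pos' (fun i _ => ht i)
    ⟨0, Finset.mem_univ _, lt_of_le_of_ne (ht 0) ht0.symm⟩
  have hmono : ∀ {P P' : (ℕ → ℕ+) → Prop}, (∀ a, P a → P' a) →
      dimH (monotoneDigitSet f P) ≤ dimH (monotoneDigitSet f P') := fun h =>
    dimH_mono fun x ⟨hx, a, hxa, ha, hP⟩ => ⟨hx, a, hxa, ha, h a hP⟩
  have hmain := dimH_liminf_le_dimH_limSet hf ht hT α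
  have h1 : dimH (limSet f t α) ≤ dimH (limsupSet f t α) := hmono fun a h => h.limsup_eq
  have h2 : dimH (limSet f t α) ≤ dimH (liminfSet f t α) := hmono fun a h => h.liminf_eq
  have h3 : dimH (limsupSet f t α) ≤ dimH (limSet f t α) :=
    (hmono fun a h => (liminf_le_limsup).trans h.le).trans hmain
  have h4 : dimH (liminfSet f t α) ≤ dimH (limSet f t α) :=
    (hmono fun a h => le_of_eq h).trans hmain
  exact ⟨le_antisymm h1 h3, (le_antisymm h1 h3).symm.trans (le_antisymm h2 h4)⟩
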